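/- A finite digraph $G$ is \emph{simple} if it has no loops and there is at most one directed edge between any two distinct vertices. A \emph{tournament} is a loopless digraph with exactly one directed edge between any two distinct vertices. The out-neighborhood complex $\overrightarrow{\mathcal N}(G)$ is the simplicial complex whose faces are the nonempty sets $s\subseteq V(G)$ contained in an out-neighborhood $\{w : (v,w)\in E(G)\}$ of some vertex $v$. Write $\tilde H_i$ for reduced simplicial homology with integer coefficients. A simplicial complex $X$ is \emph{$n$-Leray} if $\tilde H_i(Y)=0$ for every induced subcomplex $Y$ of $X$ and every $i\ge n$. A \emph{simplicial collapse} of $X$ removes all faces $\gamma$ with $\tau\subseteq\gamma\subseteq\sigma$, where $\tau\subsetneq\sigma$ are (nonempty) faces of $X$ and $\sigma$ is the only facet of $X$ containing $\tau$; $X$ \emph{collapses onto} $Y$ if a finite sequence of simplicial collapses leads from $X$ to $Y$. \textbf{Theorem.} Let $n\ge 0$ be an integer. (1) If $G$ is a simple digraph on at most $2n+2$ vertices, then $\tilde H_i(\overrightarrow{\mathcal N}(G))=0$ for all $i\ge n$, and moreover $\overrightarrow{\mathcal N}(G)$ is $n$-Leray. (2) The bound $2n+2$ is tight for $n\ge 1$: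 if $n\ge1$, there is a tournament $T$ on $2n+3$ vertices such that $\overrightarrow{\mathcal N}(T)$ collapses onto the boundary of a simplex of dimension $n+1$, the geometric realization of $\overrightarrow{\mathcal N}(T)$ is homotopy equivalent to the sphere $\mathbb S^n$, and $\tilde H_n(\overrightarrow{\mathcal N}(T))\cong\mathbb Z$; in particular $\overrightarrow{\mathcal N}(T)$ is not $n$-Leray. -/

import Mathlib

open scoped ContinuousMap

namespace Digraph

variable {V : Type*}

/-- A digraph is simple if it has no loops and there is at most one directed edge between any two
distinct vertices. -/
def IsSimple (G : Digraph V) : Prop :=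
  (∀ v, ¬ G.Adj v v) ∧ ∀ v w, v ≠ w → ¬ (G.Adj v w ∧ G.Adj w v)

/-- A tournament: an orientation of the complete graph, i.e. a loopless digraph with exactly one
directed edge between any two distinct vertices. -/
def IsTournament (G : Digraph V) : Prop :=
  (∀ v, ¬ G.Adj v v) ∧ ∀ v w, v ≠ w → Xor (G.Adj v w) (G.Adj w v)

/-- The out-neighborhood of a vertex. -/
def outNbhd (G : Digraph V) (v : V) : Set V := {w | G.Adj v w}

/-- The out-neighborhood complex of a digraph: the complex generated by the out-neighborhoods.
Its vertices (the singletons that are faces) are the vertices of positive indegree. -/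
def outNbhdComplex (G : Digraph V) : PreAbstractSimplicialComplex V where
  faces := {s | s.Nonempty ∧ ∃ v, (s : Set V) ⊆ G.outNbhd v}
  isRelLowerSet_faces := by
    rintro s ⟨hs, v, hv⟩
    exact ⟨hs, fun t hts ht => ⟨ht, v, (Finset.coe_subset.2 hts).trans hv⟩⟩

end Digraph

namespace PreAbstractSimplicialComplex

variable {V : Type*}

/-- The subcomplex of `K` induced on a set `W` of vertices. -/
def induce (K : PreAbstractSimplicialComplex V) (W : Set V) : PreAbstractSimplicialComplex V where
  faces := {s | s ∈ K ∧ (s : Set V) ⊆ W}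
  isRelLowerSet_faces := by
    rintro s ⟨hs, hW⟩
    refine ⟨(K.isRelLowerSet_faces hs).1, fun t hts ht => ⟨?_, ?_⟩⟩
    · exact (K.isRelLowerSet_faces hs).2 hts ht
    · exact (Finset.coe_subset.2 hts).trans hW

/-- The boundary of the simplex with vertex set `S`: all nonempty proper subsets of `S`. -/
def simplexBoundary (S : Finset V) : PreAbstractSimplicialComplex V where
  faces := {s | s.Nonempty ∧ s ⊂ S}
  isRelLowerSet_faces := by
    rintro s ⟨hs, hS⟩
    exact ⟨hs, fun t hts ht => ⟨ht, lt_of_le_of_lt hts hS⟩⟩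

/-- `L` is a simplicial collapse of `K`: there are faces `τ ⊊ σ` of `K` such that `σ` is the only
facet of `K` containing `τ` (every face containing `τ` lies in `σ`), and `L` is obtained from `K` by
removing all faces `γ` with `τ ⊆ γ ⊆ σ`. -/
def IsCollapse (K L : PreAbstractSimplicialComplex V) : Prop :=
  ∃ τ ∈ K, ∃ σ ∈ K, τ ⊂ σ ∧ (∀ γ ∈ K, τ ⊆ γ → γ ⊆ σ) ∧
    ∀ γ, γ ∈ L ↔ γ ∈ K ∧ ¬ (τ ⊆ γ ∧ γ ⊆ σ)

/-- `K` collapses onto `L`: a finite sequence of simplicial collapses leads from `K` to `L`. -/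
def CollapsesOnto (K L : PreAbstractSimplicialComplex V) : Prop :=
  Relation.ReflTransGen IsCollapse K L

/-! ### Reduced integral simplicial homology of a finite simplicial complex

An oriented chain whose simplices have `p` vertices is a formal integral combination of the
oriented simplices `[t 0, …, t (p - 1)]` of `K`, where permuting the vertices multiplies an oriented
simplex by the sign of the permutation. On a finite vertex set it is recorded by its coefficients:
`c t` is the coefficient of `[t 0, …, t (p - 1)]`, an alternating function of the tuple `t` that is
supported on the tuples of distinct vertices spanning a simplex of `K`. For `p = 0` the empty
simplex is allowed, which gives the augmented (reduced) complex. -/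

/-- The group of oriented integral chains of `K` on simplices with `p` vertices (that is, of
dimension `p - 1`). -/
def chains (K : PreAbstractSimplicialComplex V) (p : ℕ) : Submodule ℤ ((Fin p → V) → ℤ) where
  carrier := {c |
    (∀ (σ : Equiv.Perm (Fin p)) (t : Fin p → V), c (t ∘ σ) = (Equiv.Perm.sign σ : ℤ) * c t) ∧
    ∀ t : Fin p → V, c t ≠ 0 →
      Function.Injective t ∧ ∃ s : Finset V, (s = ∅ ∨ s ∈ K) ∧ (s : Set V) = Set.range t}
  zero_mem' := ⟨fun _ _ => by simp, fun _ h => absurd rfl h⟩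
  add_mem' := by
    rintro a b ⟨ha, ha'⟩ ⟨hb, hb'⟩
    refine ⟨fun σ t => by simp only [Pi.add_apply, ha, hb]; ring, fun t h => ?_⟩
    by_cases h0 : a t = 0
    · exact hb' t fun h1 => h (by simp [h0, h1])
    · exact ha' t h0
  smul_mem' := by
    rintro z a ⟨ha, ha'⟩
    refine ⟨fun σ t => by simp only [Pi.smul_apply, smul_eq_mul, ha]; ring, fun t h => ?_⟩
    exact ha' t fun h0 => h (by simp [h0])

variable [Fintype V]

/-- The boundary map. By `∂[v₀, …, v_p] = ∑ i, (-1)^i [v₀, …, v̂ᵢ, …, v_p]`, the coefficient of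
`[t 0, …, t (p - 1)]` in `∂ c` is the sum over all vertices `v` of the coefficient of
`[v, t 0, …, t (p - 1)]` in `c`. For `p = 0` it is the augmentation. -/
def boundary (K : PreAbstractSimplicialComplex V) (p : ℕ) : K.chains (p + 1) →ₗ[ℤ] K.chains p where
  toFun c := ⟨fun t => ∑ v : V, c.1 (Fin.cons v t), by
    obtain ⟨c, hc, hc'⟩ := c
    refine ⟨fun σ t => ?_, fun t h => ?_⟩
    · rw [Finset.mul_sum]
      refine Finset.sum_congr rfl fun v _ => ?_
      have h := hc (Equiv.Perm.decomposeFin.symm (0, σ)) (Fin.cons v t)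
      have h2 : (Fin.cons v t : Fin (p + 1) → V) ∘ (Equiv.Perm.decomposeFin.symm (0, σ)) =
          Fin.cons v (t ∘ σ) := by
        funext i
        refine Fin.cases ?_ (fun j => ?_) i
        · simp
        · simp
      rw [h2] at h
      simpa using h
    · obtain ⟨v, -, hv⟩ := Finset.exists_ne_zero_of_sum_ne_zero h
      obtain ⟨hi, s, hs, hr⟩ := hc' _ hv
      refine ⟨fun i j hij => Fin.succ_injective _ (hi (by simpa using hij)), ?_⟩
      classical
      refine ⟨Finset.univ.image t, ?_, by simp⟩
      by_cases he : Finset.univ.image t = ∅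
      · exact Or.inl he
      · refine Or.inr ?_
        have hsub : Finset.univ.image t ⊆ s := by
          intro x hx
          obtain ⟨i, -, rfl⟩ := Finset.mem_image.1 hx
          rw [← Finset.mem_coe, hr]
          exact ⟨i.succ, by simp⟩
        rcases hs with rfl | hs
        · exact absurd (Finset.subset_empty.1 hsub) he
        · exact (K.isRelLowerSet_faces hs).2 hsub (Finset.nonempty_iff_ne_empty.2 he)⟩
  map_add' a b := by
    ext t
    simp [Finset.sum_add_distrib]
  map_smul' z a := by
    ext t
    simp [Finset.mul_sum]

/-- The composition of two successive boundary maps is zero. -/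
theorem boundary_boundary (K : PreAbstractSimplicialComplex V) (p : ℕ) (c : K.chains (p + 2)) :
    K.boundary p (K.boundary (p + 1) c) = 0 := by
  ext t
  change ∑ v : V, ∑ w : V, c.1 (Fin.cons w (Fin.cons v t)) = 0
  have key : ∀ v w : V, c.1 (Fin.cons w (Fin.cons v t)) = -c.1 (Fin.cons v (Fin.cons w t)) := by
    intro v w
    have h := c.2.1 (Equiv.swap 0 1) (Fin.cons v (Fin.cons w t))
    have h2 : (Fin.cons v (Fin.cons w t) : Fin (p + 2) → V) ∘ (Equiv.swap 0 1) =
        Fin.cons w (Fin.cons v t) := by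
      funext i
      refine Fin.cases ?_ (fun j => Fin.cases ?_ (fun k => ?_) j) i
      · simp only [Function.comp_apply, Equiv.swap_apply_left]
        rfl
      · have : (Fin.succ 0 : Fin (p + 2)) = 1 := rfl
        simp only [Function.comp_apply, this, Equiv.swap_apply_right]
        rfl
      · rw [Function.comp_apply, Equiv.swap_apply_of_ne_of_ne]
        · rfl
        · exact Fin.succ_ne_zero _
        · exact fun h => Fin.succ_ne_zero _ (Fin.succ_injective _ h)
    rw [h2, Equiv.Perm.sign_swap (by simp)] at h
    simpa using h
  have h1 : ∑ v : V, ∑ w : V, c.1 (Fin.cons w (Fin.cons v t)) =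
      -∑ v : V, ∑ w : V, c.1 (Fin.cons w (Fin.cons v t)) := by
    conv_lhs => rw [Finset.sum_comm]
    rw [← Finset.sum_neg_distrib]
    refine Finset.sum_congr rfl fun v _ => ?_
    rw [← Finset.sum_neg_distrib]
    exact Finset.sum_congr rfl fun w _ => key w v
  linarith

/-- The `i`-th reduced integral homology group `H̃ᵢ(K)`: cycles of dimension `i` (on simplices with
`i + 1` vertices) modulo boundaries of chains of dimension `i + 1`. -/
abbrev ReducedHomology (K : PreAbstractSimplicialComplex V) (i : ℕ) : Type _ :=
  LinearMap.ker (K.boundary i) ⧸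
    (LinearMap.range (K.boundary (i + 1))).submoduleOf (LinearMap.ker (K.boundary i))

/-- `K` is `n`-Leray if `H̃ᵢ(Y) = 0` for every induced subcomplex `Y` of `K` and every `i ≥ n`. -/
def IsLeray (K : PreAbstractSimplicialComplex V) (n : ℕ) : Prop :=
  ∀ (W : Set V) (i : ℕ), n ≤ i → Subsingleton ((K.induce W).ReducedHomology i)

/-- The geometric realization of a finite simplicial complex, in barycentric coordinates. -/
def realization (K : PreAbstractSimplicialComplex V) : Set (V → ℝ) :=
  {x | (∀ v, 0 ≤ x v) ∧ ∑ v, x v = 1 ∧ ∃ s ∈ K, ∀ v, v ∉ s → x v = 0}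

end PreAbstractSimplicialComplex

/-!
Let `R` be the adjacency relation of `G`. For sets `A` of sources and `B` of targets, let `D(A, B)`
be the complex of the sets `s ⊆ B` contained in the out-neighborhood of some `a ∈ A`; the induced
subcomplexes of the out-neighborhood complex are the `D(V, W)`. The vanishing theorem is the case
`A = V`, `B = W` of the following bound (`AltChain.le_card_of_not_acyclic`): if the reduced homology
of `D(A, B)` in degree `p - 1` is nonzero, then `2 * p + 1 ≤ |A ∪ B|`. It is proved by induction on
`p`, then on `|A| + |B|`. Removing a source `a` replaces `D(A, B)` by `D(A \ a, B)`, and by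
Mayer–Vietoris the homology lost comes, one degree lower, from `D(A \ a, B ∩ N⁺(a))`. Removing a
target `b` is deletion of a vertex, whose link is `D(A ∩ N⁻(b), B \ b)`. In a minimal counterexample
all these smaller complexes have homology in degree `p - 2`, so by induction each of them involves
at least `2 * p - 1` vertices. Comparing sizes, every source dominates `B \ A`, and all of `A \ B`
dominates every target; as `D(A, B)` is not a cone, this gives `A = B`, and `|A| = 2 * p`. Now all
the links are extremal for the bound in the previous degree, and an extremal pair has at least `p`
sources (`AltChain.le_card_source_of_not_acyclic`). So every vertex of `A` has in-degree at least `p`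
within `A`, which is more than half of `|A| - 1`; no loopless antisymmetric relation allows this.

For tightness, `extremalTournament n` has vertices `0, …, n + 1` spanning a simplex `S`, and `n + 1`
further vertices each of which dominates one facet of `S`, while the vertex `0` dominates the
remaining facet. The vertices outside `S` can be deleted one after the other, each being dominated
(its link is a cone) at its turn, until the boundary of `S` remains. Such a deletion is a sequence of
simplicial collapses, a homotopy equivalence by linear motion of barycentric weight, and preserves
acyclicity of the complex in which `S` is filled in. The latter makes the coefficient at `S` an
isomorphism from the homology in degree `n` to `ℤ`. Finally, radial projection identifies the
boundary of `S` with a sphere.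
-/

/-! ### Alternating chains supported on a family of sets -/

namespace AltChain

variable {V : Type*}

/-- The alternating integral functions of `p`-tuples that are supported on the tuples whose range
belongs to the family `F`. For a lower set `F` these are the oriented chains on `p` vertices of the
simplicial complex `F`. Unlike `PreAbstractSimplicialComplex`, such a family distinguishes the
complex without any face, `∅`, from the complex `{∅}`. Tuples with a repeated entry need not be
excluded, as an alternating integral function vanishes on them. -/
def altChains (F : Set (Set V)) (p : ℕ) : Submodule ℤ ((Fin p → V) → ℤ) where
  carrier := {c |
    (∀ (σ : Equiv.Perm (Fin p)) (t : Fin p → V), c (t ∘ σ) = (Equiv.Perm.sign σ : ℤ) * c t) ∧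
    ∀ t : Fin p → V, c t ≠ 0 → Set.range t ∈ F}
  zero_mem' := ⟨fun _ _ => by simp, fun _ h => absurd rfl h⟩
  add_mem' := by
    rintro a b ⟨ha, ha'⟩ ⟨hb, hb'⟩
    refine ⟨fun σ t => by simp only [Pi.add_apply, ha, hb]; ring, fun t h => ?_⟩
    by_cases h0 : a t = 0
    · exact hb' t fun h1 => h (by simp [h0, h1])
    · exact ha' t h0
  smul_mem' := by
    rintro z a ⟨ha, ha'⟩
    refine ⟨fun σ t => by simp only [Pi.smul_apply, smul_eq_mul, ha]; ring, fun t h => ?_⟩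
    exact ha' t fun h0 => h (by simp [h0])

theorem injective_of_ne_zero {F : Set (Set V)} {p : ℕ} {c : (Fin p → V) → ℤ}
    (hc : c ∈ altChains F p) {t : Fin p → V} (ht : c t ≠ 0) : Function.Injective t := by
  intro i j hij
  by_contra hne
  have h := hc.1 (Equiv.swap i j) t
  have h2 : t ∘ Equiv.swap i j = t := by
    funext k
    simp only [Function.comp_apply, Equiv.swap_apply_def]
    split_ifs with h1 h2
    · rw [h1, hij]
    · rw [h2, hij]
    · rfl
  rw [h2, Equiv.Perm.sign_swap hne] at h
  simp at h
  omega

theorem altChains_mono {F F' : Set (Set V)} (h : F ⊆ F') (p : ℕ) :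
    altChains F p ≤ altChains F' p :=
  fun _ hc => ⟨hc.1, fun t ht => h (hc.2 t ht)⟩

theorem mem_altChains_of_support {F F' : Set (Set V)} {p : ℕ} {c : (Fin p → V) → ℤ}
    (hc : c ∈ altChains F p) (h : ∀ t, Function.Injective t → c t ≠ 0 → Set.range t ∈ F') :
    c ∈ altChains F' p :=
  ⟨hc.1, fun t ht => h t (injective_of_ne_zero hc ht) ht⟩

/-- The oriented chains of `K` on at least one vertex only depend on its nonempty faces, so any
family with the same nonempty members gives the same chains. -/
theorem chains_eq_altChains (K : PreAbstractSimplicialComplex V) {F : Set (Set V)}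
    (hF : ∀ s : Finset V, s.Nonempty → ((s : Set V) ∈ F ↔ s ∈ K)) (p : ℕ) :
    K.chains (p + 1) = altChains F (p + 1) := by
  classical
  have hr : ∀ t : Fin (p + 1) → V, (↑(Finset.univ.image t) : Set V) = Set.range t := by simp
  have hne : ∀ t : Fin (p + 1) → V, (Finset.univ.image t).Nonempty := by simp
  ext c
  constructor
  · rintro ⟨h1, h2⟩
    refine ⟨h1, fun t ht => ?_⟩
    obtain ⟨-, s, hs, hst⟩ := h2 t ht
    have hs' : s = Finset.univ.image t := by
      apply Finset.coe_injective
      rw [hst, hr]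
    subst hs'
    rw [← hr, hF _ (hne t)]
    exact hs.resolve_left (hne t).ne_empty
  · intro h
    refine ⟨h.1, fun t ht => ⟨injective_of_ne_zero h ht, Finset.univ.image t, Or.inr ?_, hr t⟩⟩
    rw [← hF _ (hne t), hr]
    exact h.2 t ht

theorem eq_zero_of_forall_range_not_mem {F : Set (Set V)} {p : ℕ} {c : (Fin p → V) → ℤ}
    (hc : c ∈ altChains F p) (h : ∀ t : Fin p → V, Set.range t ∉ F) : c = 0 := by
  funext t
  by_contra h0
  exact h t (hc.2 t h0)

/-- The part of a chain supported on a subfamily. -/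
theorem indicator_mem {F G : Set (Set V)} {p : ℕ} {c : (Fin p → V) → ℤ}
    (hc : c ∈ altChains F p) :
    {t | Set.range t ∈ G}.indicator c ∈ altChains (F ∩ G) p := by
  classical
  refine ⟨fun σ t => ?_, fun t ht => ?_⟩
  · have h : Set.range (t ∘ σ) = Set.range t := EquivLike.range_comp t σ
    simp only [Set.indicator_apply, Set.mem_ofPred_eq, h, hc.1]
    split_ifs <;> simp
  · simp only [Set.indicator_apply, Set.mem_ofPred_eq] at ht
    split_ifs at ht with h
    · exact ⟨hc.2 t ht, h⟩
    · exact absurd rfl ht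

/-- The complex of all nonempty finite sets of vertices. -/
def fullComplex (V : Type*) : PreAbstractSimplicialComplex V where
  faces := {s | s.Nonempty}
  isRelLowerSet_faces := fun _ hs => ⟨hs, fun _ _ ht => ht⟩

theorem mem_fullComplex_chains {F : Set (Set V)} {p : ℕ} {c : (Fin p → V) → ℤ}
    (hc : c ∈ altChains F p) : c ∈ (fullComplex V).chains p := by
  classical
  refine ⟨hc.1, fun t ht => ⟨injective_of_ne_zero hc ht, Finset.univ.image t, ?_, by simp⟩⟩
  exact (Finset.univ.image t).eq_empty_or_nonempty

/-- If `e` is alternating in all its arguments but the first, then its signed sum over the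
transpositions moving an argument to the front is alternating. -/
theorem sum_swap_alternating {p : ℕ} (e : (Fin (p + 1) → V) → ℤ)
    (he : ∀ (τ : Equiv.Perm (Fin p)) (t : Fin (p + 1) → V),
      e (t ∘ Equiv.Perm.decomposeFin.symm (0, τ)) = (Equiv.Perm.sign τ : ℤ) * e t)
    (σ : Equiv.Perm (Fin (p + 1))) (t : Fin (p + 1) → V) :
    ∑ j, (Equiv.Perm.sign (Equiv.swap 0 j) : ℤ) * e ((t ∘ σ) ∘ Equiv.swap 0 j) =
      (Equiv.Perm.sign σ : ℤ) *
        ∑ j, (Equiv.Perm.sign (Equiv.swap 0 j) : ℤ) * e (t ∘ Equiv.swap 0 j) := by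
  -- Up to the factor `p!`, the sum is the full antisymmetrization of `e`.
  have key : ∀ t : Fin (p + 1) → V,
      ∑ π : Equiv.Perm (Fin (p + 1)), (Equiv.Perm.sign π : ℤ) * e (t ∘ π) =
        (p.factorial : ℤ) *
          ∑ j, (Equiv.Perm.sign (Equiv.swap 0 j) : ℤ) * e (t ∘ Equiv.swap 0 j) := by
    intro t
    rw [← Equiv.sum_comp Equiv.Perm.decomposeFin.symm, Fintype.sum_prod_type, Finset.mul_sum]
    refine Finset.sum_congr rfl fun j _ => ?_
    have h : ∀ τ : Equiv.Perm (Fin p), Equiv.Perm.decomposeFin.symm (j, τ) =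
        Equiv.swap 0 j * Equiv.Perm.decomposeFin.symm (0, τ) := by
      intro τ
      ext i
      refine Fin.cases ?_ (fun k => ?_) i <;> simp
    have h2 : ∀ τ : Equiv.Perm (Fin p),
        (Equiv.Perm.sign (Equiv.Perm.decomposeFin.symm (j, τ)) : ℤ) *
          e (t ∘ Equiv.Perm.decomposeFin.symm (j, τ)) =
        (Equiv.Perm.sign (Equiv.swap 0 j) : ℤ) * e (t ∘ Equiv.swap 0 j) := by
      intro τ
      have h3 : t ∘ (Equiv.swap 0 j * Equiv.Perm.decomposeFin.symm (0, τ) :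
          Equiv.Perm (Fin (p + 1))) =
          (t ∘ Equiv.swap 0 j) ∘ Equiv.Perm.decomposeFin.symm (0, τ) := rfl
      have h4 : Equiv.Perm.sign (Equiv.Perm.decomposeFin.symm ((0 : Fin (p + 1)), τ)) =
          Equiv.Perm.sign τ := by simp
      rw [h, h3, he, Equiv.Perm.sign_mul, h4]
      have h5 : ((Equiv.Perm.sign τ : ℤˣ) : ℤ) * (Equiv.Perm.sign τ : ℤ) = 1 := by
        rw [← Units.val_mul, Int.units_mul_self, Units.val_one]
      push_cast
      linear_combination
        (Equiv.Perm.sign (Equiv.swap 0 j) : ℤ) * e (t ∘ Equiv.swap 0 j) * h5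
    rw [Finset.sum_congr rfl fun τ _ => h2 τ]
    simp [Fintype.card_perm]
  have hp : (p.factorial : ℤ) ≠ 0 := by exact_mod_cast p.factorial_ne_zero
  apply mul_left_cancel₀ hp
  rw [← key, mul_left_comm, ← key, Finset.mul_sum, ← Equiv.sum_comp (Equiv.mulLeft σ⁻¹)]
  refine Finset.sum_congr rfl fun π _ => ?_
  have h1 : (t ∘ σ) ∘ (Equiv.mulLeft σ⁻¹ π : Equiv.Perm (Fin (p + 1))) = t ∘ π := by
    funext i
    simp
  rw [h1]
  simp [mul_assoc]

variable [Fintype V]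

/-- The boundary map on integral functions of tuples. -/
def bd (V : Type*) [Fintype V] (p : ℕ) :
    ((Fin (p + 1) → V) → ℤ) →ₗ[ℤ] ((Fin p → V) → ℤ) where
  toFun c t := ∑ v : V, c (Fin.cons v t)
  map_add' a b := by
    ext t
    simp [Finset.sum_add_distrib]
  map_smul' z a := by
    ext t
    simp [Finset.mul_sum]

theorem bd_apply {p : ℕ} (c : (Fin (p + 1) → V) → ℤ) (t : Fin p → V) :
    bd V p c t = ∑ v : V, c (Fin.cons v t) := rfl

theorem bd_mem {F : Set (Set V)} (hF : IsLowerSet F) {p : ℕ} {c : (Fin (p + 1) → V) → ℤ}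
    (hc : c ∈ altChains F (p + 1)) : bd V p c ∈ altChains F p := by
  refine ⟨((fullComplex V).boundary p ⟨c, mem_fullComplex_chains hc⟩).2.1, fun t ht => ?_⟩
  obtain ⟨v, -, hv⟩ := Finset.exists_ne_zero_of_sum_ne_zero ht
  refine hF ?_ (hc.2 _ hv)
  rintro x ⟨i, rfl⟩
  exact ⟨i.succ, by simp⟩

theorem bd_bd {F : Set (Set V)} {p : ℕ} {c : (Fin (p + 2) → V) → ℤ}
    (hc : c ∈ altChains F (p + 2)) : bd V p (bd V (p + 1) c) = 0 :=
  congrArg Subtype.val ((fullComplex V).boundary_boundary p ⟨c, mem_fullComplex_chains hc⟩)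

/-- `Acyclic F p` says that the augmented chain complex of the family `F` is exact at the chains
on `p` vertices, i.e. that the reduced homology of `F` in degree `p - 1` vanishes. -/
def Acyclic (F : Set (Set V)) : ℕ → Prop
  | 0 => ∀ c ∈ altChains F 0, ∃ d ∈ altChains F 1, bd V 0 d = c
  | p + 1 => ∀ c ∈ altChains F (p + 1), bd V p c = 0 →
      ∃ d ∈ altChains F (p + 2), bd V (p + 1) d = c

theorem subsingleton_reducedHomology (K : PreAbstractSimplicialComplex V) {F : Set (Set V)}
    (hF : ∀ s : Finset V, s.Nonempty → ((s : Set V) ∈ F ↔ s ∈ K)) {i : ℕ}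
    (h : Acyclic F (i + 1)) : Subsingleton (K.ReducedHomology i) := by
  rw [Submodule.Quotient.subsingleton_iff, eq_top_iff]
  rintro ⟨⟨c, hc⟩, hc0⟩ -
  obtain ⟨d, hd, hdc⟩ := h c (by rwa [← chains_eq_altChains K hF])
    (congrArg Subtype.val (LinearMap.mem_ker.1 hc0))
  exact ⟨⟨d, by rwa [chains_eq_altChains K hF]⟩, Subtype.ext hdc⟩

/-- A family whose chains on `p` vertices vanish is exact there. -/
theorem Acyclic.of_forall_range_not_mem {F : Set (Set V)} {p : ℕ}
    (h : ∀ t : Fin p → V, Set.range t ∉ F) : Acyclic F p := by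
  cases p with
  | zero =>
    intro c hc
    exact ⟨0, zero_mem _, by rw [eq_zero_of_forall_range_not_mem hc h, map_zero]⟩
  | succ p =>
    intro c hc _
    exact ⟨0, zero_mem _, by rw [eq_zero_of_forall_range_not_mem hc h, map_zero]⟩

/-! ### Cones and the Mayer–Vietoris argument -/

/-- Replacing one argument of a cycle by a variable and summing gives zero. -/
theorem sum_update_eq_zero {F : Set (Set V)} {p : ℕ} {c : (Fin (p + 1) → V) → ℤ}
    (hc : c ∈ altChains F (p + 1)) (h : bd V p c = 0) (t : Fin (p + 1) → V) (k : Fin (p + 1)) :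
    ∑ w : V, c (Function.update t k w) = 0 := by
  have h1 : ∀ w, c (Function.update t k w) = (Equiv.Perm.sign (Equiv.swap 0 k) : ℤ) *
      c (Fin.cons w (Fin.tail (t ∘ Equiv.swap 0 k))) := by
    intro w
    rw [← hc.1]
    congr 1
    funext i
    simp only [Function.comp_apply]
    by_cases hi : i = k
    · subst hi
      simp
    · rw [Function.update_of_ne hi]
      have h0 : Equiv.swap 0 k i ≠ 0 := by
        intro h
        apply hi
        rw [← Equiv.swap_apply_left 0 k] at h
        simpa using congrArg (Equiv.swap 0 k) h
      obtain ⟨j, hj⟩ := Fin.exists_succ_eq.2 h0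
      rw [← hj, Fin.cons_succ, Fin.tail, Function.comp_apply, hj, Equiv.swap_apply_self]
  rw [Finset.sum_congr rfl fun w _ => h1 w, ← Finset.mul_sum]
  have := congrFun h (Fin.tail (t ∘ Equiv.swap 0 k))
  rw [bd_apply] at this
  rw [this, Pi.zero_apply, mul_zero]

/-- A cone is acyclic: coning off a cycle from the apex exhibits it as a boundary. -/
theorem Acyclic.of_cone {F : Set (Set V)} (hF : IsLowerSet F) (v : V)
    (hv : ∀ s ∈ F, insert v s ∈ F) (p : ℕ) : Acyclic F p := by
  classical
  have main : ∀ c ∈ altChains F p, (∀ (t : Fin p → V) k, ∑ w : V, c (Function.update t k w) = 0) →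
      ∃ d ∈ altChains F (p + 1), bd V p d = c := by
    intro c hc hcyc
    let e : (Fin (p + 1) → V) → ℤ := fun t => if t 0 = v then c (Fin.tail t) else 0
    refine ⟨fun t => ∑ j, (Equiv.Perm.sign (Equiv.swap 0 j) : ℤ) * e (t ∘ Equiv.swap 0 j),
      ⟨fun σ t => sum_swap_alternating e (fun τ t => ?_) σ t, fun t ht => ?_⟩, ?_⟩
    · have h1 : Fin.tail (t ∘ Equiv.Perm.decomposeFin.symm (0, τ)) = Fin.tail t ∘ τ := by
        funext i
        simp [Fin.tail]
      simp only [e, h1, hc.1]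
      simp
    · obtain ⟨j, -, hj⟩ := Finset.exists_ne_zero_of_sum_ne_zero ht
      have he : e (t ∘ Equiv.swap 0 j) ≠ 0 := right_ne_zero_of_mul hj
      simp only [e] at he
      split_ifs at he with h0
      · refine hF ?_ (hv _ (hc.2 _ he))
        rintro x ⟨i, rfl⟩
        obtain ⟨k, rfl⟩ := (Equiv.swap 0 j).surjective i
        refine Fin.cases ?_ (fun k => ?_) k
        · exact Or.inl h0
        · exact Or.inr ⟨k, rfl⟩
      · exact absurd rfl he
    · funext t
      rw [bd_apply, Finset.sum_comm, Fin.sum_univ_succ]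
      have h0 : ∑ w : V, (Equiv.Perm.sign (Equiv.swap (0 : Fin (p + 1)) 0) : ℤ) *
          e ((Fin.cons w t : Fin (p + 1) → V) ∘ Equiv.swap (0 : Fin (p + 1)) 0) = c t := by
        simp [e]
      have h1 : ∀ k : Fin p, ∑ w : V, (Equiv.Perm.sign (Equiv.swap 0 k.succ) : ℤ) *
          e ((Fin.cons w t : Fin (p + 1) → V) ∘ Equiv.swap 0 k.succ) = 0 := by
        intro k
        have h2 : ∀ w : V, Fin.tail ((Fin.cons w t : Fin (p + 1) → V) ∘ Equiv.swap 0 k.succ) =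
            Function.update t k w := by
          intro w
          funext i
          simp only [Fin.tail, Function.comp_apply]
          by_cases hi : i = k
          · subst hi
            simp
          · rw [Equiv.swap_apply_of_ne_of_ne (Fin.succ_ne_zero _)
              (fun h => hi (Fin.succ_injective _ h)), Function.update_of_ne hi, Fin.cons_succ]
        rw [← Finset.mul_sum]
        simp only [e, h2]
        simp only [Function.comp_apply, Equiv.swap_apply_left, Fin.cons_succ]
        split_ifs
        · rw [hcyc, mul_zero]
        · simp
      rw [h0, Finset.sum_congr rfl fun k _ => h1 k]
      simp
  cases p with
  | zero => exact fun c hc => main c hc fun _ k => k.elim0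
  | succ p => exact fun c hc h => main c hc (sum_update_eq_zero hc h)

/-- The family of all subsets of `C` is exact at chains on at least one vertex. -/
theorem Acyclic.powerset (C : Set V) (p : ℕ) : Acyclic {s : Set V | s ⊆ C} (p + 1) := by
  rcases C.eq_empty_or_nonempty with rfl | ⟨v, hv⟩
  · apply Acyclic.of_forall_range_not_mem
    intro t ht
    exact ht ⟨0, rfl⟩
  · exact Acyclic.of_cone (fun s t hts hs => hts.trans hs) v
      (fun s hs => Set.insert_subset hv hs) _

/-- The part of the Mayer–Vietoris sequence bounding the homology of a union. -/
theorem Acyclic.union {F₁ F₂ : Set (Set V)} (h₁ : IsLowerSet F₁) (h₂ : IsLowerSet F₂) {p : ℕ}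
    (a₁ : Acyclic F₁ (p + 1)) (a₂ : Acyclic F₂ (p + 1)) (a : Acyclic (F₁ ∩ F₂) p) :
    Acyclic (F₁ ∪ F₂) (p + 1) := by
  intro c hc hc0
  set c₁ := {t | Set.range t ∈ F₁}.indicator c with hc₁
  have m₁ : c₁ ∈ altChains F₁ (p + 1) :=
    altChains_mono Set.inter_subset_right _ (indicator_mem hc)
  have m₂ : c - c₁ ∈ altChains F₂ (p + 1) := by
    have hsub := sub_mem hc (altChains_mono (Set.subset_union_left (t := F₂)) _ m₁)
    refine mem_altChains_of_support hsub fun t _ ht => ?_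
    have h3 : Set.range t ∉ F₁ := fun h => ht (by simp [hc₁, h])
    exact (hsub.2 t ht).resolve_left h3
  -- The boundary of the `F₁`-part of `c` is a cycle of the intersection.
  have hb : bd V p c₁ ∈ altChains (F₁ ∩ F₂) p := by
    have e : bd V p c₁ = - bd V p (c - c₁) := by rw [map_sub, hc0, zero_sub, neg_neg]
    refine ⟨(bd_mem h₁ m₁).1, fun t ht => ⟨(bd_mem h₁ m₁).2 t ht, ?_⟩⟩
    rw [e] at ht
    exact (neg_mem (bd_mem h₂ m₂)).2 t ht
  obtain ⟨e, he, hee⟩ : ∃ e ∈ altChains (F₁ ∩ F₂) (p + 1), bd V p e = bd V p c₁ := by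
    cases p with
    | zero => exact a _ hb
    | succ p => exact a _ hb (bd_bd m₁)
  obtain ⟨d₁, hd₁, e₁⟩ := a₁ (c₁ - e)
    (sub_mem m₁ (altChains_mono Set.inter_subset_left _ he)) (by rw [map_sub, hee, sub_self])
  obtain ⟨d₂, hd₂, e₂⟩ := a₂ (c - c₁ + e)
    (add_mem m₂ (altChains_mono Set.inter_subset_right _ he))
    (by rw [map_add, map_sub, hee, hc0]; simp)
  refine ⟨d₁ + d₂, add_mem (altChains_mono Set.subset_union_left _ hd₁)
    (altChains_mono Set.subset_union_right _ hd₂), ?_⟩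
  rw [map_add, e₁, e₂]
  abel

/-- Deletion and link of a vertex `v`: homology of the complex is bounded by that of the deletion
and, one degree lower, that of the link. -/
theorem Acyclic.of_deletion_of_link {F : Set (Set V)} (hF : IsLowerSet F) (v : V) {p : ℕ}
    (hd : Acyclic {s ∈ F | v ∉ s} (p + 1)) (hl : Acyclic {s | v ∉ s ∧ insert v s ∈ F} p) :
    Acyclic F (p + 1) := by
  have l₁ : IsLowerSet {s ∈ F | v ∉ s} :=
    fun s t hts hs => ⟨hF hts hs.1, fun h => hs.2 (hts h)⟩
  have l₂ : IsLowerSet {s | insert v s ∈ F} :=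
    fun s t hts hs => hF (Set.insert_subset_insert hts) hs
  have e : F = {s ∈ F | v ∉ s} ∪ {s | insert v s ∈ F} := by
    ext s
    constructor
    · intro hs
      by_cases h : v ∈ s
      · right
        simpa [Set.insert_eq_of_mem h] using hs
      · exact Or.inl ⟨hs, h⟩
    · rintro (h | h)
      · exact h.1
      · exact hF (Set.subset_insert _ _) h
  have e2 : {s ∈ F | v ∉ s} ∩ {s | insert v s ∈ F} = {s | v ∉ s ∧ insert v s ∈ F} := by
    ext s
    constructor
    · exact fun h => ⟨h.1.2, h.2⟩
    · exact fun h => ⟨⟨hF (Set.subset_insert _ _) h.2, h.1⟩, h.2⟩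
  rw [e]
  refine Acyclic.union l₁ l₂ hd (Acyclic.of_cone l₂ v (fun s hs => ?_) _) (by rwa [e2])
  simpa using hs

end AltChain

/-! ### Vanishing of homology for loopless and antisymmetric relations -/

namespace AltChain

variable {V : Type*} (R : V → V → Prop)

/-- The sets of targets in `B` that have a common source in `A`. This is the complex induced on `B`
by the subsets of `B` related to a single `a ∈ A`; it contains the empty set unless `A` is empty. -/
def dowker (A B : Finset V) : Set (Set V) := {s | s ⊆ B ∧ ∃ a ∈ A, ∀ x ∈ s, R a x}

variable {R}

theorem isLowerSet_dowker (A B : Finset V) : IsLowerSet (dowker R A B) :=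
  fun _ _ hts hs => ⟨hts.trans hs.1, hs.2.imp fun _ h => ⟨h.1, fun x hx => h.2 x (hts hx)⟩⟩

/-- In an antisymmetric loopless relation, the in-degrees within a nonempty set are on average
less than half its size. -/
theorem exists_two_mul_indegree_lt [DecidableEq V] [DecidableRel R] (hl : ∀ v, ¬ R v v)
    (ha : ∀ v w, R v w → ¬ R w v) {U : Finset V} (hU : U.Nonempty) :
    ∃ b ∈ U, 2 * (U.filter fun a => R a b).card < U.card := by
  by_contra! h
  have hd : ∀ b ∈ U, (U.filter fun a => R a b).card + (U.filter fun a => R b a).card + 1 ≤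
      U.card := by
    intro b hb
    have hdisj : Disjoint (U.filter fun a => R a b) (U.filter fun a => R b a) := by
      rw [Finset.disjoint_filter]
      exact fun a _ h1 h2 => ha _ _ h1 h2
    rw [← Finset.card_union_of_disjoint hdisj, Nat.succ_le_iff]
    apply Finset.card_lt_card
    refine ⟨fun x hx => ?_, fun hs => ?_⟩
    · simp only [Finset.mem_union, Finset.mem_filter] at hx
      tauto
    · have := hs hb
      simp [hl] at this
  have hs : ∑ b ∈ U, (U.filter fun a => R a b).card = ∑ b ∈ U, (U.filter fun a => R b a).card :=
    (Finset.sum_card_bipartiteAbove_eq_sum_card_bipartiteBelow R (s := U) (t := U)).symm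
  have h1 := Finset.sum_le_sum hd
  have h2 := Finset.sum_le_sum h
  rw [Finset.sum_add_distrib, Finset.sum_add_distrib, ← hs] at h1
  rw [← Finset.mul_sum] at h2
  simp only [Finset.sum_const, smul_eq_mul] at h1 h2
  have := hU.card_pos
  omega

variable [Fintype V]

theorem Acyclic.dowker_empty (B : Finset V) (p : ℕ) : Acyclic (dowker R ∅ B) p := by
  apply Acyclic.of_forall_range_not_mem
  rintro t ⟨-, a, ha, -⟩
  simp at ha

/-- A target common to all sources is the apex of a cone. -/
theorem Acyclic.dowker_of_target {A B : Finset V} {b : V} (hb : b ∈ B) (h : ∀ a ∈ A, R a b)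
    (p : ℕ) : Acyclic (dowker R A B) p := by
  refine Acyclic.of_cone (isLowerSet_dowker A B) b ?_ p
  rintro s ⟨hs, a, ha, hR⟩
  refine ⟨Set.insert_subset hb hs, a, ha, ?_⟩
  rintro x (rfl | hx)
  · exact h a ha
  · exact hR x hx

/-- A source related to all targets makes the complex a full simplex. -/
theorem Acyclic.dowker_of_source {A B : Finset V} {a : V} (ha : a ∈ A) (h : ∀ b ∈ B, R a b)
    (p : ℕ) : Acyclic (dowker R A B) (p + 1) := by
  have e : dowker R A B = {s : Set V | s ⊆ B} :=
    Set.ext fun s => ⟨fun hs => hs.1, fun hs => ⟨hs, a, ha, fun x hx => h x (hs hx)⟩⟩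
  rw [e]
  exact Acyclic.powerset _ p

variable [DecidableEq V] [DecidableRel R]

/-- Removing the facet of a source `a`. -/
theorem Acyclic.dowker_of_erase_source {A B : Finset V} {a : V} (ha : a ∈ A) {p : ℕ}
    (h₁ : Acyclic (dowker R (A.erase a) B) (p + 1))
    (h₂ : Acyclic (dowker R (A.erase a) (B.filter (R a))) p) :
    Acyclic (dowker R A B) (p + 1) := by
  have e : dowker R A B = dowker R (A.erase a) B ∪ {s | s ⊆ (B.filter (R a) : Finset V)} := by
    ext s
    constructor
    · rintro ⟨hs, a', ha', hR⟩
      by_cases h : a' = a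
      · subst h
        right
        intro x hx
        simpa using ⟨hs hx, hR x hx⟩
      · exact Or.inl ⟨hs, a', Finset.mem_erase.2 ⟨h, ha'⟩, hR⟩
    · rintro (⟨hs, a', ha', hR⟩ | hs)
      · exact ⟨hs, a', Finset.mem_of_mem_erase ha', hR⟩
      · exact ⟨fun x hx => (Finset.mem_filter.1 (hs hx)).1, a, ha,
          fun x hx => (Finset.mem_filter.1 (hs hx)).2⟩
  have e2 : dowker R (A.erase a) B ∩ {s | s ⊆ (B.filter (R a) : Finset V)} =
      dowker R (A.erase a) (B.filter (R a)) := by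
    ext s
    exact ⟨fun h => ⟨h.2, h.1.2⟩,
      fun h => ⟨⟨fun x hx => (Finset.mem_filter.1 (h.1 hx)).1, h.2⟩, h.1⟩⟩
  have l : IsLowerSet {s : Set V | s ⊆ (B.filter (R a) : Finset V)} :=
    fun s t hts hs => hts.trans hs
  rw [e]
  exact Acyclic.union (isLowerSet_dowker _ _) l h₁ (Acyclic.powerset _ p) (by rwa [e2])

/-- Removing a target `b`. -/
theorem Acyclic.dowker_of_erase_target {A B : Finset V} {b : V} (hb : b ∈ B) {p : ℕ}
    (h₁ : Acyclic (dowker R A (B.erase b)) (p + 1))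
    (h₂ : Acyclic (dowker R (A.filter fun a => R a b) (B.erase b)) p) :
    Acyclic (dowker R A B) (p + 1) := by
  have e₁ : {s ∈ dowker R A B | b ∉ s} = dowker R A (B.erase b) := by
    ext s
    constructor
    · rintro ⟨⟨hs, h⟩, hbs⟩
      exact ⟨fun x hx => Finset.mem_coe.2 (Finset.mem_erase.2 ⟨fun e => hbs (e ▸ hx), hs hx⟩), h⟩
    · rintro ⟨hs, h⟩
      exact ⟨⟨fun x hx => Finset.mem_of_mem_erase (hs hx), h⟩,
        fun h => Finset.notMem_erase b B (hs h)⟩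
  have e₂ : {s | b ∉ s ∧ insert b s ∈ dowker R A B} =
      dowker R (A.filter fun a => R a b) (B.erase b) := by
    ext s
    constructor
    · rintro ⟨hbs, hs, a, ha, hR⟩
      exact ⟨fun x hx => Finset.mem_coe.2 (Finset.mem_erase.2
        ⟨fun e => hbs (e ▸ hx), hs (Or.inr hx)⟩), a,
        Finset.mem_filter.2 ⟨ha, hR b (Or.inl rfl)⟩, fun x hx => hR x (Or.inr hx)⟩
    · rintro ⟨hs, a, ha, hR⟩
      obtain ⟨ha, hab⟩ := Finset.mem_filter.1 ha
      refine ⟨fun h => Finset.notMem_erase b B (hs h), Set.insert_subset hb fun x hx =>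
        Finset.mem_of_mem_erase (hs hx), a, ha, ?_⟩
      rintro x (rfl | hx)
      · exact hab
      · exact hR x hx
  exact Acyclic.of_deletion_of_link (isLowerSet_dowker A B) b (by rwa [e₁]) (by rwa [e₂])

/-- The number of sources is large in the extremal case of the bound `2 * p + 1 ≤ |A ∪ B|`. In a
minimal example, a source `a` may miss at most one target outside `A`, since otherwise removing `a`
and two missed targets contradicts the bound in the previous degree, while each of these targets is
missed by some source. -/
theorem le_card_source_of_not_acyclic (hl : ∀ v, ¬ R v v) {p : ℕ}
    (H : ∀ q ≤ p, ∀ A B : Finset V, ¬ Acyclic (dowker R A B) q → 2 * q + 1 ≤ (A ∪ B).card)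
    (A B : Finset V) (hAB : ¬ Acyclic (dowker R A B) p) (hc : (A ∪ B).card ≤ 2 * p + 1) :
    p + 1 ≤ A.card := by
  induction A using Finset.strongInduction with
  | H A ih =>
    have hA : A.Nonempty := by
      rw [Finset.nonempty_iff_ne_empty]
      rintro rfl
      exact hAB (Acyclic.dowker_empty B p)
    cases p with
    | zero => exact hA.card_pos
    | succ q =>
      by_cases h : ∃ a ∈ A, ¬ Acyclic (dowker R (A.erase a) B) (q + 1)
      · obtain ⟨a, ha, hna⟩ := h
        have := ih (A.erase a) (Finset.erase_ssubset ha) hna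
          ((Finset.card_le_card (Finset.union_subset_union_left (Finset.erase_subset a A))).trans
            hc)
        exact this.trans (Finset.card_le_card (Finset.erase_subset a A))
      push Not at h
      have key : ∀ a ∈ A, 2 * q + 1 ≤ (A.erase a ∪ B.filter (R a)).card := fun a ha =>
        H q q.le_succ _ _ fun h2 => hAB (Acyclic.dowker_of_erase_source ha (h a ha) h2)
      have hm := H (q + 1) le_rfl A B hAB
      have hmiss : ∀ b : V, ∃ a ∈ A, b ∈ B \ A → ¬ R a b := by
        intro b
        by_cases hb : b ∈ B \ A
        · by_contra! hall
          exact hAB (Acyclic.dowker_of_target (Finset.mem_sdiff.1 hb).1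
            (fun a ha => (hall a ha).2) _)
        · exact hA.imp fun a ha => ⟨ha, fun h => absurd h hb⟩
      choose f hfA hf using hmiss
      have hle : (B \ A).card ≤ A.card := by
        refine Finset.card_le_card_of_injOn f (fun b _ => hfA b) ?_
        intro b hb b' hb' hbb
        by_contra hne
        have hb1 := Finset.mem_sdiff.1 hb
        have hb1' := Finset.mem_sdiff.1 hb'
        have hsub : A.erase (f b) ∪ B.filter (R (f b)) ⊆
            (((A ∪ B).erase b).erase b').erase (f b) := by
          intro x hx
          simp only [Finset.mem_union, Finset.mem_erase, Finset.mem_filter] at hx ⊢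
          have n1 := hf b hb
          have n2 := hf b' hb'
          rw [← hbb] at n2
          rcases hx with hx | hx
          · exact ⟨hx.1, fun e => hb1'.2 (e ▸ hx.2), fun e => hb1.2 (e ▸ hx.2), Or.inl hx.2⟩
          · exact ⟨fun e => hl _ (e ▸ hx.2), fun e => n2 (e ▸ hx.2), fun e => n1 (e ▸ hx.2),
              Or.inr hx.1⟩
        have h1 := (key (f b) (hfA b)).trans (Finset.card_le_card hsub)
        have m1 : b ∈ A ∪ B := Finset.mem_union_right _ hb1.1
        have m2 : b' ∈ (A ∪ B).erase b :=
          Finset.mem_erase.2 ⟨fun e => hne e.symm, Finset.mem_union_right _ hb1'.1⟩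
        have m3 : f b ∈ ((A ∪ B).erase b).erase b' := by
          refine Finset.mem_erase.2 ⟨fun e => hb1'.2 (e ▸ hfA b), Finset.mem_erase.2
            ⟨fun e => hb1.2 (?_ : b ∈ A), Finset.mem_union_left _ (hfA b)⟩⟩
          rw [← e]
          exact hfA b
        rw [Finset.card_erase_of_mem m3, Finset.card_erase_of_mem m2,
          Finset.card_erase_of_mem m1] at h1
        omega
      have : (A ∪ B).card = A.card + (B \ A).card := by
        rw [← Finset.card_union_of_disjoint Finset.disjoint_sdiff, Finset.union_sdiff_self_eq_union]
      omega

/-- If the complex of a loopless antisymmetric relation has nonzero reduced homology in degree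
`p - 1`, then sources and targets together are at least `2 * p + 1` in number. -/
theorem le_card_of_not_acyclic (hl : ∀ v, ¬ R v v) (ha : ∀ v w, R v w → ¬ R w v) (p : ℕ) :
    ∀ A B : Finset V, ¬ Acyclic (dowker R A B) p → 2 * p + 1 ≤ (A ∪ B).card := by
  induction p using Nat.strong_induction_on with
  | _ p IH =>
    cases p with
    | zero =>
      intro A B hAB
      by_contra hc
      have hc0 : A ∪ B = ∅ := Finset.card_eq_zero.1 (by omega)
      have : A = ∅ := by
        rw [← Finset.subset_empty]
        exact Finset.subset_union_left.trans hc0.le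
      subst this
      exact hAB (Acyclic.dowker_empty B 0)
    | succ p =>
      intro A B
      induction hk : A.card + B.card using Nat.strong_induction_on generalizing A B with
      | _ k ih =>
        intro hAB
        by_contra! hc
        -- By minimality, the homology survives in each link, in one degree less.
        have hsrc : ∀ a ∈ A, 2 * p + 1 ≤ (A.erase a ∪ B.filter (R a)).card := by
          intro a haA
          refine IH p p.lt_succ_self _ _ fun h2 => hAB (Acyclic.dowker_of_erase_source haA ?_ h2)
          by_contra h1
          have h3 := ih _ (by have := Finset.card_erase_lt_of_mem haA; omega) _ _ rfl h1
          have h4 := Finset.card_le_card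
            (Finset.union_subset_union_left (t := B) (Finset.erase_subset a A))
          omega
        have htgt : ∀ b ∈ B, ¬ Acyclic (dowker R (A.filter fun a => R a b) (B.erase b)) p := by
          intro b hbB h2
          refine hAB (Acyclic.dowker_of_erase_target hbB ?_ h2)
          by_contra h1
          have h3 := ih _ (by have := Finset.card_erase_lt_of_mem hbB; omega) _ _ rfl h1
          have h4 := Finset.card_le_card
            (Finset.union_subset_union_right (s := A) (Finset.erase_subset b B))
          omega
        have htgt' := fun b hb => IH p p.lt_succ_self _ _ (htgt b hb)
        -- A link that loses two vertices contradicts the bound, so every target is a source.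
        have hBA : B ⊆ A := by
          intro b hb
          by_contra hbA
          refine hAB (Acyclic.dowker_of_target hb (fun a haA => ?_) _)
          by_contra hR
          have hsub : A.erase a ∪ B.filter (R a) ⊆ ((A ∪ B).erase b).erase a := by
            intro x hx
            simp only [Finset.mem_union, Finset.mem_erase, Finset.mem_filter] at hx ⊢
            rcases hx with hx | hx
            · exact ⟨hx.1, fun e => hbA (e ▸ hx.2), Or.inl hx.2⟩
            · exact ⟨fun e => hl a (e ▸ hx.2), fun e => hR (e ▸ hx.2), Or.inr hx.1⟩
          have h1 := (hsrc a haA).trans (Finset.card_le_card hsub)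
          rw [Finset.card_erase_of_mem, Finset.card_erase_of_mem] at h1
          · omega
          · exact Finset.mem_union_right _ hb
          · exact Finset.mem_erase.2 ⟨fun e => hbA (e ▸ haA), Finset.mem_union_left _ haA⟩
        -- For the same reason, every source is a target.
        have hAB' : A ⊆ B := by
          intro a haA
          by_contra haB
          refine hAB (Acyclic.dowker_of_source haA (fun b hb => ?_) _)
          by_contra hR
          have hsub : (A.filter fun a => R a b) ∪ B.erase b ⊆ ((A ∪ B).erase b).erase a := by
            intro x hx
            simp only [Finset.mem_union, Finset.mem_erase, Finset.mem_filter] at hx ⊢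
            rcases hx with hx | hx
            · exact ⟨fun e => hR (e ▸ hx.2), fun e => hl b (e ▸ hx.2), Or.inl hx.1⟩
            · exact ⟨fun e => haB (e ▸ hx.2), hx.1, Or.inr hx.2⟩
          have h1 := (htgt' b hb).trans (Finset.card_le_card hsub)
          rw [Finset.card_erase_of_mem, Finset.card_erase_of_mem] at h1
          · omega
          · exact Finset.mem_union_right _ hb
          · exact Finset.mem_erase.2 ⟨fun e => haB (e ▸ hb), Finset.mem_union_left _ haA⟩
        obtain rfl : A = B := Finset.Subset.antisymm hAB' hBA
        rw [Finset.union_self] at hc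
        have hne : A.Nonempty := by
          rw [Finset.nonempty_iff_ne_empty]
          rintro rfl
          exact hAB (Acyclic.dowker_empty _ _)
        -- All links are extremal, so all in-degrees are too large.
        obtain ⟨b, hb, hlt⟩ := exists_two_mul_indegree_lt hl ha hne
        have hsub : (A.filter fun a => R a b) ∪ A.erase b ⊆ A.erase b := by
          refine Finset.union_subset (fun x hx => ?_) subset_rfl
          rw [Finset.mem_filter] at hx
          exact Finset.mem_erase.2 ⟨fun e => hl b (e ▸ hx.2), hx.1⟩
        have h1 := Finset.card_le_card hsub
        have h2 := htgt' b hb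
        rw [Finset.card_erase_of_mem hb] at h1
        have h3 := le_card_source_of_not_acyclic hl
          (fun q hq => IH q (Nat.lt_succ_of_le hq)) _ _ (htgt b hb) (by omega)
        omega

end AltChain

theorem Digraph.IsSimple.isLeray_outNbhdComplex {V : Type*} [Fintype V] {G : Digraph V}
    (hG : G.IsSimple) {n : ℕ} (hn : Fintype.card V ≤ 2 * n + 2) : G.outNbhdComplex.IsLeray n := by
  classical
  intro W i hi
  refine AltChain.subsingleton_reducedHomology _
    (F := AltChain.dowker G.Adj Finset.univ W.toFinset) (fun s hs => ?_) ?_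
  · constructor
    · rintro ⟨hsW, a, -, hR⟩
      exact ⟨⟨hs, a, hR⟩, by simpa using hsW⟩
    · rintro ⟨⟨-, a, hR⟩, hsW⟩
      exact ⟨by simpa using hsW, a, Finset.mem_univ a, hR⟩
  · by_contra h
    have ha : ∀ v w, G.Adj v w → ¬ G.Adj w v := fun v w h1 h2 =>
      hG.2 v w (fun e => hG.1 v (by rwa [← e] at h1)) ⟨h1, h2⟩
    have := AltChain.le_card_of_not_acyclic hG.1 ha (i + 1) _ _ h
    have := this.trans (Finset.card_le_univ _)
    omega

theorem PreAbstractSimplicialComplex.induce_univ {V : Type*} (K : PreAbstractSimplicialComplex V) :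
    K.induce Set.univ = K := by
  apply PreAbstractSimplicialComplex.ext
  ext s
  exact ⟨fun h => h.1, fun h => ⟨h, Set.subset_univ _⟩⟩

/-! ### Deleting dominated vertices -/

namespace PreAbstractSimplicialComplex

variable {V : Type*}

theorem mem_of_subset (K : PreAbstractSimplicialComplex V) {s t : Finset V} (hs : s ∈ K)
    (hts : t ⊆ s) (ht : t.Nonempty) : t ∈ K :=
  (K.isRelLowerSet_faces hs).2 hts ht

section

variable [DecidableEq V]

/-- `L` is obtained from `K` by deleting a vertex `x` outside `S` that is dominated by another
vertex `y`: whenever `x` belongs to a face, adding `y` to that face gives a face. In other words,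
the link of `x` is a cone with apex `y` (or `x` is not a vertex of `K`). -/
def IsDominatedDeletion (S : Finset V) (K L : PreAbstractSimplicialComplex V) : Prop :=
  ∃ x ∉ S, ∃ y, y ≠ x ∧ (∀ γ ∈ K, x ∈ γ → insert y γ ∈ K) ∧ ∀ γ, γ ∈ L ↔ γ ∈ K ∧ x ∉ γ

/-- The faces inside `S` are not affected by dominated deletions outside `S`. -/
theorem mem_iff_of_dominatedDeletions {S : Finset V} {K L : PreAbstractSimplicialComplex V}
    (h : Relation.ReflTransGen (IsDominatedDeletion S) K L) {γ : Finset V} (hγ : γ ⊆ S) :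
    γ ∈ K ↔ γ ∈ L := by
  induction h with
  | refl => rfl
  | tail _ hs ih =>
    obtain ⟨x, hx, y, -, -, hL⟩ := hs
    rw [ih, hL]
    exact ⟨fun h => ⟨h, fun hxγ => hx (hγ hxγ)⟩, fun h => h.1⟩

/-- A dominated vertex can be removed by simplicial collapses: the faces containing `x` are removed
in pairs `τ`, `insert y τ`, a largest `τ` first. -/
theorem IsDominatedDeletion.collapsesOnto [Finite V] {S : Finset V}
    {K L : PreAbstractSimplicialComplex V} (h : IsDominatedDeletion S K L) :
    K.CollapsesOnto L := by
  obtain ⟨x, -, y, hyx, hdom, hL⟩ := h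
  induction hk : {γ : Finset V | γ ∈ K ∧ x ∈ γ}.ncard using Nat.strong_induction_on
    generalizing K with
  | _ k ih =>
    by_cases hx : ∃ γ ∈ K, x ∈ γ
    · obtain ⟨γ₀, hγ₀, hxγ₀⟩ := hx
      have hfin : {γ : Finset V | γ ∈ K ∧ x ∈ γ ∧ y ∉ γ}.Finite := Set.toFinite _
      have hne : {γ : Finset V | γ ∈ K ∧ x ∈ γ ∧ y ∉ γ}.Nonempty := by
        have hx' : x ∈ γ₀.erase y := Finset.mem_erase.2 ⟨hyx.symm, hxγ₀⟩
        exact ⟨γ₀.erase y, K.mem_of_subset hγ₀ (Finset.erase_subset _ _) ⟨x, hx'⟩, hx',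
          Finset.notMem_erase _ _⟩
      obtain ⟨τ, ⟨hτ, hxτ, hyτ⟩, hmax⟩ := hfin.exists_maximal hne
      have huniq : ∀ γ ∈ K, τ ⊆ γ → γ ⊆ insert y τ := by
        intro γ hγ hτγ
        have hx' : x ∈ γ.erase y := Finset.mem_erase.2 ⟨hyx.symm, hτγ hxτ⟩
        have hsub : τ ⊆ γ.erase y :=
          fun v hv => Finset.mem_erase.2 ⟨fun e => hyτ (e ▸ hv), hτγ hv⟩
        have := hmax ⟨K.mem_of_subset hγ (Finset.erase_subset _ _) ⟨x, hx'⟩, hx',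
          Finset.notMem_erase _ _⟩ hsub
        intro v hv
        by_cases e : v = y
        · exact Finset.mem_insert.2 (Or.inl e)
        · exact Finset.mem_insert_of_mem (this (Finset.mem_erase.2 ⟨e, hv⟩))
      let M : PreAbstractSimplicialComplex V :=
        { faces := {γ | γ ∈ K ∧ ¬ (τ ⊆ γ ∧ γ ⊆ insert y τ)}
          isRelLowerSet_faces := fun s hs => ⟨(K.isRelLowerSet_faces hs.1).1, fun t hts ht =>
            ⟨K.mem_of_subset hs.1 hts ht, fun h =>
              hs.2 ⟨h.1.trans hts, huniq s hs.1 (h.1.trans hts)⟩⟩⟩ }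
      have hM : ∀ γ, γ ∈ M ↔ γ ∈ K ∧ ¬ (τ ⊆ γ ∧ γ ⊆ insert y τ) := fun _ => Iff.rfl
      have hstep : IsCollapse K M :=
        ⟨τ, hτ, insert y τ, hdom τ hτ hxτ, Finset.ssubset_insert hyτ, huniq, hM⟩
      refine Relation.ReflTransGen.head hstep (ih _ ?_ ?_ ?_ rfl)
      · rw [← hk]
        refine Set.ncard_lt_ncard ⟨fun γ hγ => ⟨((hM γ).1 hγ.1).1, hγ.2⟩, fun hsub => ?_⟩
          (Set.toFinite _)
        exact ((hM τ).1 (hsub ⟨hτ, hxτ⟩).1).2 ⟨subset_rfl, Finset.subset_insert _ _⟩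
      · intro γ hγ hxγ
        rw [hM] at hγ ⊢
        refine ⟨hdom γ hγ.1 hxγ, fun h => hγ.2 ⟨fun v hv => ?_,
          (Finset.subset_insert _ _).trans h.2⟩⟩
        exact (Finset.mem_insert.1 (h.1 hv)).resolve_left fun e => hyτ (e ▸ hv)
      · intro γ
        rw [hL, hM]
        exact ⟨fun h => ⟨⟨h.1, fun h2 => h.2 (h2.1 hxτ)⟩, h.2⟩, fun h => ⟨h.1.1, h.2⟩⟩
    · push Not at hx
      have : K = L := by
        apply PreAbstractSimplicialComplex.ext
        ext γ
        exact ⟨fun h => (hL γ).2 ⟨h, hx γ h⟩, fun h => ((hL γ).1 h).1⟩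
      rw [this]
      exact Relation.ReflTransGen.refl

theorem collapsesOnto_of_dominatedDeletions [Finite V] {S : Finset V}
    {K L : PreAbstractSimplicialComplex V}
    (h : Relation.ReflTransGen (IsDominatedDeletion S) K L) : K.CollapsesOnto L := by
  induction h with
  | refl => exact Relation.ReflTransGen.refl
  | tail _ hs ih => exact Relation.ReflTransGen.trans ih hs.collapsesOnto

/-- A dominated deletion does not change the homotopy type: the barycentric weight of `x` is moved
to `y` linearly. -/
theorem IsDominatedDeletion.homotopyEquiv [Fintype V] {S : Finset V}
    {K L : PreAbstractSimplicialComplex V} (h : IsDominatedDeletion S K L) :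
    Nonempty (K.realization ≃ₕ L.realization) := by
  obtain ⟨x, -, y, hyx, hdom, hL⟩ := h
  let push : ℝ → (V → ℝ) → V → ℝ := fun t z => z + (t * z x) • (Pi.single y 1 - Pi.single x 1)
  have push_x : ∀ t z, push t z x = (1 - t) * z x := by
    intro t z
    simp [push, hyx.symm]
    ring
  have push_y : ∀ t z, push t z y = z y + t * z x := by
    intro t z
    simp [push, hyx]
  have push_other : ∀ t z v, v ≠ x → v ≠ y → push t z v = z v := by
    intro t z v h1 h2
    simp [push, h1, h2]
  have push_cont : Continuous fun q : ℝ × (V → ℝ) => push q.1 q.2 := by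
    simp only [push]
    fun_prop
  have push_nonneg : ∀ t z, 0 ≤ t → t ≤ 1 → (∀ v, 0 ≤ z v) → ∀ v, 0 ≤ push t z v := by
    intro t z h0 h1 hz v
    by_cases hvx : v = x
    · subst hvx
      rw [push_x]
      exact mul_nonneg (by linarith) (hz _)
    by_cases hvy : v = y
    · subst hvy
      rw [push_y]
      exact add_nonneg (hz _) (mul_nonneg h0 (hz _))
    · rw [push_other t z v hvx hvy]
      exact hz v
  have push_sum : ∀ t z, ∑ v, push t z v = ∑ v, z v := by
    intro t z
    simp [push, Finset.sum_add_distrib, ← Finset.mul_sum, Finset.sum_sub_distrib]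
  have push_K : ∀ t z, 0 ≤ t → t ≤ 1 → z ∈ K.realization → push t z ∈ K.realization := by
    rintro t z h0 h1 ⟨hz, hsum, s, hs, hsupp⟩
    refine ⟨push_nonneg t z h0 h1 hz, by rw [push_sum, hsum], ?_⟩
    by_cases hxs : x ∈ s
    · refine ⟨insert y s, hdom s hs hxs, fun v hv => ?_⟩
      rw [Finset.mem_insert, not_or] at hv
      rw [push_other t z v (fun e => hv.2 (e ▸ hxs)) hv.1]
      exact hsupp v hv.2
    · have : push t z = z := by
        simp [push, hsupp x hxs]
      rw [this]
      exact ⟨s, hs, hsupp⟩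
  have push_L : ∀ z ∈ K.realization, push 1 z ∈ L.realization := by
    intro z hz
    obtain ⟨hz', hsum, s, hs, hsupp⟩ := push_K 1 z zero_le_one le_rfl hz
    have h0 : push 1 z x = 0 := by rw [push_x]; ring
    refine ⟨hz', hsum, s.erase x, (hL _).2 ⟨K.mem_of_subset hs (Finset.erase_subset _ _) ?_,
      Finset.notMem_erase _ _⟩, fun v hv => ?_⟩
    · obtain ⟨v, -, hv⟩ := Finset.exists_ne_zero_of_sum_ne_zero (hsum.trans_ne one_ne_zero)
      refine ⟨v, Finset.mem_erase.2 ⟨fun e => hv (e ▸ h0), ?_⟩⟩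
      by_contra hvs
      exact hv (hsupp v hvs)
    · by_cases e : v = x
      · rw [e, h0]
      · exact hsupp v fun hvs => hv (Finset.mem_erase.2 ⟨e, hvs⟩)
  have hLK : L.realization ⊆ K.realization := by
    rintro z ⟨hz, hsum, s, hs, hsupp⟩
    exact ⟨hz, hsum, s, ((hL s).1 hs).1, hsupp⟩
  have push_eq : ∀ t, ∀ z ∈ L.realization, push t z = z := by
    rintro t z ⟨-, -, s, hs, hsupp⟩
    simp [push, hsupp x ((hL s).1 hs).2]
  let r : C(K.realization, L.realization) :=
    ⟨fun z => ⟨push 1 z, push_L z z.2⟩, (push_cont.comp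
      (continuous_const.prodMk continuous_subtype_val)).subtype_mk _⟩
  let i : C(L.realization, K.realization) :=
    ⟨fun z => ⟨z, hLK z.2⟩, continuous_subtype_val.subtype_mk _⟩
  refine ⟨⟨r, i, ⟨⟨⟨fun q => ⟨push (1 - q.1) q.2, push_K _ _ (by linarith [q.1.2.2])
    (by linarith [q.1.2.1]) q.2.2⟩, ?_⟩, fun z => ?_, fun z => ?_⟩⟩, ?_⟩⟩
  · refine (push_cont.comp (Continuous.prodMk ?_ ?_)).subtype_mk _
    · fun_prop
    · fun_prop
  · apply Subtype.ext
    simp [r, i]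
  · apply Subtype.ext
    simp [push]
  · have : r.comp i = ContinuousMap.id _ := by
      ext z : 1
      apply Subtype.ext
      simp [r, i, push_eq 1 z z.2]
    rw [this]

theorem homotopyEquiv_of_dominatedDeletions [Fintype V] {S : Finset V}
    {K L : PreAbstractSimplicialComplex V}
    (h : Relation.ReflTransGen (IsDominatedDeletion S) K L) :
    Nonempty (K.realization ≃ₕ L.realization) := by
  induction h with
  | refl => exact ⟨ContinuousMap.HomotopyEquiv.refl _⟩
  | tail _ hs ih =>
    obtain ⟨e⟩ := ih
    obtain ⟨e'⟩ := hs.homotopyEquiv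
    exact ⟨e.trans e'⟩

end

/-! ### Top homology of a complex that a missing simplex makes acyclic -/

/-- The complex `K` together with all subsets of `S`. -/
def fill (K : PreAbstractSimplicialComplex V) (S : Finset V) : Set (Set V) :=
  {s | s ⊆ S ∨ ∃ γ ∈ K, (γ : Set V) = s}

theorem isLowerSet_fill (K : PreAbstractSimplicialComplex V) (S : Finset V) :
    IsLowerSet (K.fill S) := by
  rintro s t hts (hs | ⟨γ, hγ, rfl⟩)
  · exact Or.inl (hts.trans hs)
  · have hfin : t.Finite := γ.finite_toSet.subset hts
    rcases t.eq_empty_or_nonempty with rfl | hne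
    · exact Or.inl (Set.empty_subset _)
    · refine Or.inr ⟨hfin.toFinset, K.mem_of_subset hγ ?_ ?_, hfin.coe_toFinset⟩
      · intro v hv
        exact hts (hfin.mem_toFinset.1 hv)
      · simpa using hne

theorem IsDominatedDeletion.acyclic_fill [Fintype V] [DecidableEq V] {S : Finset V}
    {K L : PreAbstractSimplicialComplex V} (h : IsDominatedDeletion S K L) {p : ℕ}
    (hp : AltChain.Acyclic (L.fill S) (p + 1)) : AltChain.Acyclic (K.fill S) (p + 1) := by
  obtain ⟨x, hxS, y, hyx, hdom, hL⟩ := h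
  have hlow := K.isLowerSet_fill S
  refine AltChain.Acyclic.of_deletion_of_link hlow x ?_ ?_
  · convert hp using 1
    ext s
    constructor
    · rintro ⟨hs | ⟨γ, hγ, rfl⟩, hx⟩
      · exact Or.inl hs
      · exact Or.inr ⟨γ, (hL γ).2 ⟨hγ, hx⟩, rfl⟩
    · rintro (hs | ⟨γ, hγ, rfl⟩)
      · exact ⟨Or.inl hs, fun hx => hxS (hs hx)⟩
      · exact ⟨Or.inr ⟨γ, ((hL γ).1 hγ).1, rfl⟩, ((hL γ).1 hγ).2⟩
  · have hlink : IsLowerSet {s | x ∉ s ∧ insert x s ∈ K.fill S} := fun s t hts hs =>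
      ⟨fun h => hs.1 (hts h), hlow (Set.insert_subset_insert hts) hs.2⟩
    refine AltChain.Acyclic.of_cone hlink y ?_ p
    rintro s ⟨hxs, hs⟩
    refine ⟨?_, ?_⟩
    · rintro (h | h)
      · exact hyx h.symm
      · exact hxs h
    · rcases hs with hs | ⟨γ, hγ, he⟩
      · exact absurd (hs (Set.mem_insert x s)) hxS
      · refine Or.inr ⟨insert y γ, hdom γ hγ ?_, ?_⟩
        · rw [← Finset.mem_coe, he]
          exact Set.mem_insert x s
        · rw [Finset.coe_insert, he, Set.insert_comm]

theorem acyclic_fill_of_dominatedDeletions [Fintype V] [DecidableEq V] {S : Finset V}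
    {K : PreAbstractSimplicialComplex V}
    (h : Relation.ReflTransGen (IsDominatedDeletion S) K (simplexBoundary S)) (p : ℕ) :
    AltChain.Acyclic (K.fill S) (p + 1) := by
  induction h using Relation.ReflTransGen.head_induction_on with
  | refl =>
    have : (simplexBoundary S).fill S = {s : Set V | s ⊆ S} := by
      ext s
      constructor
      · rintro (hs | ⟨γ, hγ, rfl⟩)
        · exact hs
        · exact Finset.coe_subset.2 hγ.2.1
      · exact Or.inl
    rw [this]
    exact AltChain.Acyclic.powerset _ p
  | head hs _ ih => exact hs.acyclic_fill ih

end PreAbstractSimplicialComplex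

namespace PreAbstractSimplicialComplex

open AltChain

variable {V : Type*}

/-- The oriented simplex spanned by a tuple `t₀` of distinct vertices is a chain whose coefficient at
`t₀` is `1`. -/
theorem exists_altChain_apply_eq_one {F : Set (Set V)} {p : ℕ} {t₀ : Fin p → V}
    (ht₀ : Function.Injective t₀) (hF : Set.range t₀ ∈ F) : ∃ d ∈ altChains F p, d t₀ = 1 := by
  classical
  refine ⟨fun t => ∑ σ : Equiv.Perm (Fin p),
    if t = t₀ ∘ σ then (Equiv.Perm.sign σ : ℤ) else 0, ⟨fun τ t => ?_, fun t ht => ?_⟩, ?_⟩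
  · rw [Finset.mul_sum]
    refine (Equiv.sum_comp (Equiv.mulRight τ) _).symm.trans (Finset.sum_congr rfl fun σ _ => ?_)
    have h : t ∘ τ = t₀ ∘ (Equiv.mulRight τ σ : Equiv.Perm (Fin p)) ↔ t = t₀ ∘ σ := by
      constructor
      · intro h
        funext i
        simpa using congrFun h (τ.symm i)
      · rintro rfl
        rfl
    simp only [h]
    split_ifs
    · simp [mul_comm]
    · simp
  · obtain ⟨σ, -, hσ⟩ := Finset.exists_ne_zero_of_sum_ne_zero ht
    have h : t = t₀ ∘ σ := by
      by_contra h
      exact hσ (if_neg h)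
    rw [h, EquivLike.range_comp]
    exact hF
  · have h : ∀ σ : Equiv.Perm (Fin p), t₀ = t₀ ∘ σ ↔ σ = 1 := by
      intro σ
      constructor
      · intro h
        ext i
        simpa using congrArg Fin.val (ht₀ (congrFun h i)).symm
      · rintro rfl
        rfl
    simp [h]

variable [Fintype V]

/-- If filling in the missing simplex `S` of `K` kills the homology, then the top homology of the
boundary of `S` survives as `ℤ`: a cycle of `K` is the boundary of a chain of the filled complex,
and its class is the coefficient of that chain at `S`. -/
theorem nonempty_reducedHomology_addEquiv_int {K : PreAbstractSimplicialComplex V} {S : Finset V}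
    {n : ℕ} (hcard : S.card = n + 2) (hbd : ∀ γ, γ.Nonempty → γ ⊂ S → γ ∈ K) (hS : S ∉ K)
    (h₁ : Acyclic (K.fill S) (n + 1)) (h₂ : Acyclic (K.fill S) (n + 2)) :
    Nonempty (K.ReducedHomology n ≃+ ℤ) := by
  classical
  let F₀ : Set (Set V) := {s | ∃ γ ∈ K, (γ : Set V) = s}
  have hF₀ : F₀ ⊆ K.fill S := fun s hs => Or.inr hs
  have hch : ∀ p, K.chains (p + 1) = altChains F₀ (p + 1) := by
    refine chains_eq_altChains K fun s _ => ⟨?_, fun h => ⟨s, h, rfl⟩⟩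
    rintro ⟨γ, hγ, he⟩
    rwa [← Finset.coe_injective he]
  have hcardS : ∀ {p : ℕ} (t : Fin p → V), Function.Injective t → Set.range t = S →
      p = n + 2 := by
    intro p t ht hr
    have h := Set.ncard_range_of_injective ht
    rw [hr, Set.ncard_coe_finset, hcard] at h
    simpa using h.symm
  -- A face of the filled complex other than `S` is a face of `K`.
  have hface : ∀ {p : ℕ} (t : Fin (p + 1) → V), Set.range t ∈ K.fill S → Set.range t ≠ S →
      Set.range t ∈ F₀ := by
    rintro p t (hs | hs) hne
    · refine ⟨Finset.univ.image t, hbd _ (by simp) ?_, by simp⟩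
      rw [← Finset.coe_ssubset]
      simpa using hs.ssubset_of_ne hne
    · exact hs
  have hSF₀ : (S : Set V) ∉ F₀ := by
    rintro ⟨γ, hγ, he⟩
    exact hS (by rwa [← Finset.coe_injective he])
  let t₀ : Fin (n + 2) → V := fun i => (S.equivFinOfCardEq hcard).symm i
  have ht₀ : Function.Injective t₀ :=
    Subtype.val_injective.comp (S.equivFinOfCardEq hcard).symm.injective
  have hrt₀ : Set.range t₀ = S := by
    ext v
    constructor
    · rintro ⟨i, rfl⟩
      exact Subtype.prop _
    · intro hv
      exact ⟨S.equivFinOfCardEq hcard ⟨v, hv⟩, by simp [t₀]⟩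
  have hlow : IsLowerSet (K.fill S) := K.isLowerSet_fill S
  have hbdK : ∀ d ∈ altChains (K.fill S) (n + 2), bd V (n + 1) d ∈ K.chains (n + 1) := by
    intro d hd
    rw [hch]
    have hm := bd_mem hlow hd
    refine mem_altChains_of_support hm fun t hinj ht => hface t (hm.2 t ht) fun h => ?_
    have := hcardS t hinj h
    omega
  let g : altChains (K.fill S) (n + 2) →ₗ[ℤ] LinearMap.ker (K.boundary n) :=
    LinearMap.codRestrict _ (LinearMap.codRestrict (K.chains (n + 1))
      ((bd V (n + 1)).domRestrict _) fun d => hbdK d d.2) fun d => by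
        rw [LinearMap.mem_ker]
        exact Subtype.ext (bd_bd d.2)
  let f : altChains (K.fill S) (n + 2) →ₗ[ℤ] K.ReducedHomology n := (Submodule.mkQ _).comp g
  let φ : altChains (K.fill S) (n + 2) →ₗ[ℤ] ℤ :=
    (LinearMap.proj (R := ℤ) (φ := fun _ : Fin (n + 2) → V => ℤ) t₀).domRestrict _
  have hφ : ∀ d, φ d = d.1 t₀ := fun _ => rfl
  have hfs : Function.Surjective f := by
    refine (Submodule.mkQ_surjective _).comp ?_
    rintro ⟨⟨c, hc⟩, hc0⟩
    obtain ⟨d, hd, hdc⟩ := h₁ c (altChains_mono hF₀ _ (by rwa [← hch]))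
      (congrArg Subtype.val (LinearMap.mem_ker.1 hc0))
    exact ⟨⟨d, hd⟩, Subtype.ext (Subtype.ext hdc)⟩
  have hφs : Function.Surjective φ := by
    obtain ⟨d, hd, hd1⟩ := exists_altChain_apply_eq_one ht₀
      (F := K.fill S) (Or.inl hrt₀.subset)
    intro z
    exact ⟨z • ⟨d, hd⟩, by
      rw [map_smul, show φ ⟨d, hd⟩ = 1 from hd1, smul_eq_mul, mul_one]⟩
  have hker : LinearMap.ker f = LinearMap.ker φ := by
    ext d
    rw [LinearMap.mem_ker, LinearMap.mem_ker, hφ]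
    have hf0 : f d = 0 ↔ ∃ d' ∈ K.chains (n + 2), bd V (n + 1) d' = bd V (n + 1) d := by
      change (Submodule.Quotient.mk (g d) : K.ReducedHomology n) = 0 ↔ _
      rw [Submodule.Quotient.mk_eq_zero]
      constructor
      · rintro ⟨d', h⟩
        exact ⟨d'.1, d'.2, congrArg Subtype.val h⟩
      · rintro ⟨d', hd', h⟩
        exact ⟨⟨d', hd'⟩, Subtype.ext h⟩
    rw [hf0]
    constructor
    · rintro ⟨d', hd', he⟩
      rw [hch] at hd'
      -- Chains with the same boundary differ by a boundary, which does not meet the facet `S`.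
      obtain ⟨e, hem, hed⟩ := h₂ (d.1 - d') (sub_mem d.2 (altChains_mono hF₀ _ hd'))
        (by rw [map_sub, he, sub_self])
      have h0 : d' t₀ = 0 := by
        by_contra h
        exact hSF₀ (hrt₀ ▸ hd'.2 _ h)
      have he0 : bd V (n + 2) e t₀ = 0 := by
        rw [bd_apply]
        refine Finset.sum_eq_zero fun v _ => ?_
        by_contra hne
        have hinj := injective_of_ne_zero hem hne
        have hsub : (S : Set V) ⊆ Set.range (Fin.cons v t₀ : Fin (n + 3) → V) := by
          rw [← hrt₀]
          rintro _ ⟨i, rfl⟩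
          exact ⟨i.succ, by simp⟩
        have hmem := hface _ (hem.2 _ hne) fun h => by
          have := hcardS _ hinj h
          omega
        obtain ⟨γ, hγ, hγe⟩ := hmem
        refine hS (K.mem_of_subset hγ ?_ (Finset.card_pos.1 (by omega)))
        rwa [← Finset.coe_subset, hγe]
      rw [hed] at he0
      simpa [h0] using he0
    · intro hd0
      refine ⟨d, ?_, rfl⟩
      rw [hch]
      refine mem_altChains_of_support d.2 fun t hinj ht => hface t (d.2.2 t ht) fun h => ht ?_
      -- A tuple spanning `S` is a permutation of `t₀`.
      have hσ : ∀ i, ∃ j, t₀ j = t i := fun i => by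
        have : t i ∈ Set.range t₀ := by
          rw [hrt₀, ← h]
          exact ⟨i, rfl⟩
        exact this
      choose σ hσ using hσ
      have hσi : Function.Injective σ := fun i j hij => hinj (by rw [← hσ, ← hσ, hij])
      have : t = t₀ ∘ Equiv.ofBijective σ (Finite.injective_iff_bijective.1 hσi) :=
        funext fun i => (hσ i).symm
      rw [this, d.2.1, hd0, mul_zero]
  have e₁ := f.quotKerEquivOfSurjective hfs
  rw [hker] at e₁
  exact ⟨(e₁.symm.trans (φ.quotKerEquivOfSurjective hφs)).toAddEquiv⟩

end PreAbstractSimplicialComplex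

/-! ### The boundary of a simplex is a sphere -/

namespace PreAbstractSimplicialComplex

variable {V : Type*}

/-- The sum of the values of a real function on `S`. -/
def coordSum (S : Finset V) : (S → ℝ) →ₗ[ℝ] ℝ where
  toFun y := ∑ i, y i
  map_add' _ _ := by simp [Finset.sum_add_distrib]
  map_smul' _ _ := by simp [Finset.mul_sum]

/-- The direction space of the affine hull of a simplex with vertex set `S`: the real functions on
`S` with sum zero. -/
def sumZero (S : Finset V) : Submodule ℝ (S → ℝ) := LinearMap.ker (coordSum S)

theorem mem_sumZero {S : Finset V} {y : S → ℝ} : y ∈ sumZero S ↔ ∑ i, y i = 0 := Iff.rfl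

theorem finrank_sumZero {S : Finset V} {m : ℕ} (hS : S.card = m + 1) :
    Module.finrank ℝ (sumZero S) = m := by
  classical
  obtain ⟨v, hv⟩ : S.Nonempty := Finset.card_pos.1 (by omega)
  have hsurj : Function.Surjective (coordSum S) :=
    fun r => ⟨Pi.single ⟨v, hv⟩ r, by simp [coordSum]⟩
  have h := LinearMap.finrank_range_add_finrank_ker (coordSum S)
  rw [LinearMap.range_eq_top.2 hsurj, finrank_top, Module.finrank_self,
    Module.finrank_fintype_fun_eq_card, Fintype.card_coe, hS] at h
  rw [sumZero]
  omega

variable [Fintype V]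

/-- Radial projection from the barycenter is a homeomorphism from the boundary of a simplex with
`n + 2` vertices to the unit sphere of the direction space, which has dimension `n + 1`. -/
theorem nonempty_simplexBoundary_homeomorph_sphere {S : Finset V} {n : ℕ} (hS : S.card = n + 2) :
    Nonempty ((simplexBoundary S).realization ≃ₜ
      Metric.sphere (0 : EuclideanSpace ℝ (Fin (n + 1))) 1) := by
  classical
  have hSne : S.Nonempty := Finset.card_pos.1 (by omega)
  have hne : (Finset.univ : Finset S).Nonempty := by simpa using hSne
  have hcard : (Finset.univ : Finset S).card = n + 2 := by simpa using hS
  let L : sumZero S ≃L[ℝ] EuclideanSpace ℝ (Fin (n + 1)) :=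
    ContinuousLinearEquiv.ofFinrankEq (by rw [finrank_sumZero hS]; simp)
  let b : ℝ := ((n : ℝ) + 2)⁻¹
  have hb : 0 < b := by positivity
  have hb1 : ((n : ℝ) + 2) * b = 1 := mul_inv_cancel₀ (by positivity)
  -- `M y` is the largest amount by which a coordinate of `y` is negative.
  let M : sumZero S → ℝ := fun y => Finset.univ.sup' hne fun i => -y.1 i
  have hMle : ∀ y i, -y.1 i ≤ M y := fun y i =>
    Finset.le_sup' (fun i => -y.1 i) (Finset.mem_univ i)
  have hMex : ∀ y, ∃ i, M y = -y.1 i := fun y => by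
    obtain ⟨i, -, hi⟩ := Finset.exists_mem_eq_sup' hne fun i => -y.1 i
    exact ⟨i, hi⟩
  have hMcont : Continuous M :=
    Continuous.finset_sup'_apply hne fun i _ =>
      ((continuous_apply i).comp continuous_subtype_val).neg
  have hMpos : ∀ y, y ≠ 0 → 0 < M y := by
    intro y hy
    by_contra! hM
    apply hy
    have h0 : ∀ i, 0 ≤ y.1 i := fun i => by linarith [hMle y i]
    have hs := mem_sumZero.1 y.2
    rw [Finset.sum_eq_zero_iff_of_nonneg fun i _ => h0 i] at hs
    exact Subtype.ext (funext fun i => hs i (Finset.mem_univ i))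
  have hMsmul : ∀ (c : ℝ) y, 0 ≤ c → M (c • y) = c * M y := by
    intro c y hc
    simp only [M]
    rw [Finset.mul₀_sup' hc]
    simp
  -- sums over `V` of functions supported on `S`
  have hsum : ∀ x : V → ℝ, (∀ v, v ∉ S → x v = 0) → ∑ i : S, x i = ∑ v, x v := by
    intro x hx
    rw [Finset.sum_coe_sort S x]
    exact Finset.sum_subset (Finset.subset_univ S) fun v _ hv => hx v hv
  have hsupp : ∀ x ∈ (simplexBoundary S).realization, ∀ v, v ∉ S → x v = 0 := by
    rintro x ⟨-, -, s, hs, hx⟩ v hv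
    exact hx v fun h => hv (hs.2.1 h)
  let dir : (simplexBoundary S).realization → sumZero S := fun x =>
    ⟨fun i => x.1 i - b, by
      rw [mem_sumZero, Finset.sum_sub_distrib, hsum x.1 (hsupp x.1 x.2), x.2.2.1]
      simp only [Finset.sum_const, hcard, nsmul_eq_mul]
      push_cast
      rw [hb1, sub_self]⟩
  have hdir_apply : ∀ x i, (dir x).1 i = x.1 i - b := fun _ _ => rfl
  have hdir_cont : Continuous dir :=
    Continuous.subtype_mk
      (f := fun (x : (simplexBoundary S).realization) (i : S) => x.1 i - b) (continuous_pi fun i =>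
      Continuous.sub ((continuous_apply (i : V)).comp continuous_subtype_val) continuous_const) _
  have hMdir : ∀ x, M (dir x) = b := by
    intro x
    apply le_antisymm
    · obtain ⟨i, hi⟩ := hMex (dir x)
      rw [hi, hdir_apply]
      linarith [x.2.1 i]
    · obtain ⟨-, -, s, hs, hx⟩ := x.2
      obtain ⟨v, hvS, hvs⟩ := Finset.exists_of_ssubset hs.2
      have h := hMle (dir x) ⟨v, hvS⟩
      rw [hdir_apply] at h
      simp only [hx v hvs] at h
      linarith
  have hdir_ne : ∀ x, dir x ≠ 0 := by
    intro x h0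
    have h1 := hMdir x
    obtain ⟨i, hi⟩ := hMex (dir x)
    rw [h1, h0] at hi
    simp at hi
    exact hb.ne' hi
  let ext : (S → ℝ) → V → ℝ := fun y v => if h : v ∈ S then y ⟨v, h⟩ else 0
  have ext_cont : Continuous ext := by
    refine continuous_pi fun v => ?_
    by_cases h : v ∈ S
    · simp only [ext, h, dif_pos]
      fun_prop
    · simp only [ext, h, dif_neg, not_false_eq_true]
      fun_prop
  have ext_mem : ∀ (y : S → ℝ) (i : S), ext y i = y i := fun y i => by simp [ext]
  have ext_not : ∀ (y : S → ℝ) v, v ∉ S → ext y v = 0 := fun y v h => by simp [ext, h]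
  let pt : sumZero S → S → ℝ := fun y i => b + b / M y * y.1 i
  have hpt : ∀ y, y ≠ 0 → ext (pt y) ∈ (simplexBoundary S).realization := by
    intro y hy
    have hM := hMpos y hy
    have hnn : ∀ i, 0 ≤ pt y i := by
      intro i
      have h1 : b / M y * (-y.1 i) ≤ b / M y * M y :=
        mul_le_mul_of_nonneg_left (hMle y i) (by positivity)
      rw [div_mul_cancel₀ _ hM.ne'] at h1
      simp only [pt]
      linarith
    have hs1 : ∑ v, ext (pt y) v = 1 := by
      rw [← hsum _ (ext_not _)]
      simp only [ext_mem, pt]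
      rw [Finset.sum_add_distrib, ← Finset.mul_sum, mem_sumZero.1 y.2]
      simp only [Finset.sum_const, hcard, nsmul_eq_mul]
      push_cast
      rw [hb1, mul_zero, add_zero]
    obtain ⟨i, hi⟩ := hMex y
    have hpi : pt y i = 0 := by
      simp only [pt]
      rw [show y.1 i = -M y by rw [hi, neg_neg]]
      field_simp
      ring
    refine ⟨fun v => ?_, hs1, S.erase i, ⟨?_, Finset.erase_ssubset i.2⟩, fun v hv => ?_⟩
    · by_cases h : v ∈ S
      · exact (hnn ⟨v, h⟩).trans_eq (ext_mem _ ⟨v, h⟩).symm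
      · rw [ext_not _ _ h]
    · rw [← Finset.card_pos, Finset.card_erase_of_mem i.2]
      omega
    · by_cases h : v ∈ S
      · have : v = i := by
          by_contra h2
          exact hv (Finset.mem_erase.2 ⟨h2, h⟩)
        rw [this, ext_mem, hpi]
      · exact ext_not _ _ h
  have hpt_cont : Continuous fun y : {y : sumZero S // y ≠ 0} => ext (pt y.1) := by
    have hscale : Continuous fun y : {y : sumZero S // y ≠ 0} => b / M y.1 :=
      Continuous.div continuous_const (hMcont.comp continuous_subtype_val)
        fun y => (hMpos y.1 y.2).ne'
    have hcoord : ∀ i, Continuous fun y : {y : sumZero S // y ≠ 0} => y.1.1 i := fun i =>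
      (continuous_apply i).comp (continuous_subtype_val.comp continuous_subtype_val)
    exact ext_cont.comp (continuous_pi fun i => continuous_const.add (hscale.mul (hcoord i)))
  have hpt_dir : ∀ x (c : ℝ), 0 < c → ext (pt (c • dir x)) = x.1 := by
    intro x c hc
    funext v
    by_cases h : v ∈ S
    · rw [show v = ((⟨v, h⟩ : S) : V) from rfl, ext_mem]
      simp only [pt, hMsmul c _ hc.le, hMdir]
      change b + b / (c * b) * (c * (x.1 v - b)) = x.1 v
      field_simp
      ring
    · rw [ext_not _ _ h, hsupp x.1 x.2 v h]
  have hdir_pt : ∀ y (hy : y ≠ 0), dir ⟨_, hpt y hy⟩ = (b / M y) • y := by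
    intro y hy
    apply Subtype.ext
    funext i
    rw [hdir_apply]
    simp [ext_mem, pt]
  have hLne : ∀ x, ‖L (dir x)‖ ≠ 0 := fun x h =>
    hdir_ne x (L.map_eq_zero_iff.1 (norm_eq_zero.1 h))
  have hsph : ∀ u : Metric.sphere (0 : EuclideanSpace ℝ (Fin (n + 1))) 1, L.symm u.1 ≠ 0 := by
    intro u h
    have h1 : u.1 = 0 := L.symm.map_eq_zero_iff.1 h
    have h2 : ‖u.1‖ = 1 := by simp
    rw [h1, norm_zero] at h2
    exact zero_ne_one h2
  refine ⟨⟨⟨fun x => ⟨‖L (dir x)‖⁻¹ • L (dir x), ?_⟩, fun u => ⟨ext (pt (L.symm u.1)),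
    hpt _ (hsph u)⟩, fun x => ?_, fun u => ?_⟩, ?_, ?_⟩⟩
  · rw [mem_sphere_zero_iff_norm, norm_smul, norm_inv, norm_norm, inv_mul_cancel₀ (hLne x)]
  · apply Subtype.ext
    simp only [map_smul, ContinuousLinearEquiv.symm_apply_apply]
    exact hpt_dir x _ (inv_pos.2 (lt_of_le_of_ne (norm_nonneg _) (hLne x).symm))
  · apply Subtype.ext
    have hu : ‖u.1‖ = 1 := by simp
    have hc : 0 < b / M (L.symm u.1) := div_pos hb (hMpos _ (hsph u))
    simp only [hdir_pt _ (hsph u), map_smul, ContinuousLinearEquiv.apply_symm_apply]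
    rw [norm_smul, hu, mul_one, Real.norm_of_nonneg hc.le, inv_smul_smul₀ hc.ne']
  · have hLc : Continuous fun x => L (dir x) := L.continuous.comp hdir_cont
    exact ((hLc.norm.inv₀ hLne).smul hLc).subtype_mk _
  · have hLs : Continuous fun u : Metric.sphere (0 : EuclideanSpace ℝ (Fin (n + 1))) 1 =>
        (⟨L.symm u.1, hsph u⟩ : {y : sumZero S // y ≠ 0}) :=
      (L.symm.continuous.comp continuous_subtype_val).subtype_mk hsph
    exact (hpt_cont.comp hLs).subtype_mk fun u => hpt _ (hsph u)

end PreAbstractSimplicialComplex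

/-! ### The extremal tournament -/

open PreAbstractSimplicialComplex

/-- The extremal tournament. The vertices `v < n + 2` span the simplex `S`, ordered transitively;
the other vertices are ordered transitively as well. The vertex `v + n + 1` is dominated by `v` and
dominates the rest of `S`, for `1 ≤ v ≤ n + 1`. -/
def extremalTournament (n : ℕ) : Digraph (Fin (2 * n + 3)) where
  Adj u v :=
    (u.1 < v.1 ∧ (v.1 < n + 2 ∨ n + 2 ≤ u.1)) ∨ (u.1 < n + 2 ∧ v.1 = u.1 + n + 1 ∧ n + 2 ≤ v.1) ∨
      (n + 2 ≤ u.1 ∧ v.1 < n + 2 ∧ u.1 ≠ v.1 + n + 1)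

namespace extremalTournament

theorem isTournament (n : ℕ) : (extremalTournament n).IsTournament := by
  constructor
  · intro v
    simp only [extremalTournament]
    omega
  · intro v w hvw
    have : v.1 ≠ w.1 := fun h => hvw (Fin.ext h)
    simp only [extremalTournament, xor_def]
    omega

/-- The vertex set of the simplex. -/
def simplexVertices (n : ℕ) : Finset (Fin (2 * n + 3)) := Finset.univ.filter fun v => v.1 < n + 2

theorem mem_simplexVertices {n : ℕ} {v : Fin (2 * n + 3)} :
    v ∈ simplexVertices n ↔ v.1 < n + 2 := by
  simp [simplexVertices]

theorem card_simplexVertices (n : ℕ) : (simplexVertices n).card = n + 2 := by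
  rw [simplexVertices, Fin.card_filter_val_lt]
  omega

/-- The complex obtained by deleting the first `k` vertices outside the simplex. -/
def stage (n k : ℕ) : PreAbstractSimplicialComplex (Fin (2 * n + 3)) :=
  (extremalTournament n).outNbhdComplex.induce {v | v.1 < n + 2 ∨ n + 2 + k ≤ v.1}

theorem mem_stage {n k : ℕ} {γ : Finset (Fin (2 * n + 3))} :
    γ ∈ stage n k ↔ (γ.Nonempty ∧ ∃ a, ∀ v ∈ γ, (extremalTournament n).Adj a v) ∧
      ∀ v ∈ γ, v.1 < n + 2 ∨ n + 2 + k ≤ v.1 :=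
  Iff.rfl

theorem stage_zero (n : ℕ) : stage n 0 = (extremalTournament n).outNbhdComplex := by
  apply PreAbstractSimplicialComplex.ext
  ext γ
  exact ⟨fun h => h.1, fun h => ⟨h, fun v _ => lt_or_ge _ _⟩⟩

theorem stage_last (n : ℕ) : stage n (n + 1) = simplexBoundary (simplexVertices n) := by
  apply PreAbstractSimplicialComplex.ext
  ext γ
  change γ ∈ stage n (n + 1) ↔ γ.Nonempty ∧ γ ⊂ simplexVertices n
  rw [mem_stage]
  constructor
  · rintro ⟨⟨hne, a, ha⟩, hγ⟩
    refine ⟨hne, fun v hv => ?_, fun hsub => ?_⟩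
    · have := hγ v hv
      have := v.2
      exact mem_simplexVertices.2 (by omega)
    · by_cases h : a.1 < n + 2
      · exact (isTournament n).1 a (ha a (hsub (mem_simplexVertices.2 h)))
      · have h2 := ha ⟨a.1 - (n + 1), by omega⟩
          (hsub (mem_simplexVertices.2 (by have := a.2; simp only; omega)))
        simp only [extremalTournament] at h2
        omega
  · rintro ⟨hne, hsub⟩
    have hlt : ∀ v ∈ γ, v.1 < n + 2 := fun v hv => mem_simplexVertices.1 (hsub.1 hv)
    refine ⟨⟨hne, ?_⟩, fun v hv => Or.inl (hlt v hv)⟩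
    obtain ⟨w, hwS, hwγ⟩ := Finset.exists_of_ssubset hsub
    rw [mem_simplexVertices] at hwS
    have hvw : ∀ v ∈ γ, v.1 ≠ w.1 := fun v hv h => hwγ (Fin.ext h ▸ hv)
    -- The facet of `S` opposite to `w` is contained in the out-neighborhood of `0` if `w = 0`,
    -- and of `w + n + 1` otherwise.
    by_cases h0 : w.1 = 0
    · refine ⟨w, fun v hv => ?_⟩
      have := hlt v hv
      have := hvw v hv
      simp only [extremalTournament]
      omega
    · refine ⟨⟨w.1 + n + 1, by omega⟩, fun v hv => ?_⟩
      have := hlt v hv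
      have := hvw v hv
      simp only [extremalTournament]
      omega

/-- In `stage n k`, the vertex `n + 2 + k` is dominated by `0` if `1 ≤ k`, and by `n + 1` if
`k = 0`. -/
theorem isDominatedDeletion_stage {n k : ℕ} (hn : 1 ≤ n) (hk : k < n + 1) :
    IsDominatedDeletion (simplexVertices n) (stage n k) (stage n (k + 1)) := by
  have hdel : ∀ γ, γ ∈ stage n (k + 1) ↔
      γ ∈ stage n k ∧ (⟨n + 2 + k, by omega⟩ : Fin (2 * n + 3)) ∉ γ := by
    intro γ
    rw [mem_stage, mem_stage]
    constructor
    · rintro ⟨h, hγ⟩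
      refine ⟨⟨h, fun v hv => ?_⟩, fun hx => ?_⟩
      · have := hγ v hv
        omega
      · have := hγ _ hx
        simp only at this
        omega
    · rintro ⟨⟨h, hγ⟩, hx⟩
      refine ⟨h, fun v hv => ?_⟩
      have := hγ v hv
      have : v.1 ≠ n + 2 + k := fun e => hx (by convert hv; exact e.symm)
      omega
  refine ⟨⟨n + 2 + k, by omega⟩, by simp [mem_simplexVertices], ?_⟩
  rcases Nat.eq_zero_or_pos k with rfl | hk0
  · refine ⟨⟨n + 1, by omega⟩, by simp, fun γ hγ hx => ?_, hdel⟩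
    rw [mem_stage] at hγ ⊢
    obtain ⟨⟨-, a, ha⟩, hW⟩ := hγ
    refine ⟨⟨Finset.insert_nonempty _ _, a, ?_⟩, ?_⟩
    · have h1 := ha _ hx
      rw [Finset.forall_mem_insert]
      refine ⟨?_, ha⟩
      simp only [extremalTournament] at h1 ⊢
      omega
    · rw [Finset.forall_mem_insert]
      exact ⟨by simp, hW⟩
  · refine ⟨⟨0, by omega⟩, fun e => ?_, fun γ hγ hx => ?_, hdel⟩
    · have := congrArg Fin.val e
      simp only at this
      omega
    rw [mem_stage] at hγ ⊢
    obtain ⟨⟨-, a, ha⟩, hW⟩ := hγ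
    refine ⟨⟨Finset.insert_nonempty _ _, ?_⟩, ?_⟩
    · have h1 := ha _ hx
      by_cases h : a.1 < n + 2
      · -- Here `a = k + 1`, and its remaining out-neighbors are out-neighbors of `n + 2`.
        refine ⟨⟨n + 2, by omega⟩, ?_⟩
        rw [Finset.forall_mem_insert]
        refine ⟨?_, fun v hv => ?_⟩
        · simp only [extremalTournament]
          omega
        · have h2 := ha v hv
          have h3 := hW v hv
          simp only [extremalTournament] at h1 h2 ⊢
          omega
      · refine ⟨a, ?_⟩
        rw [Finset.forall_mem_insert]
        refine ⟨?_, ha⟩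
        simp only [extremalTournament] at h1 ⊢
        omega
    · rw [Finset.forall_mem_insert]
      exact ⟨by simp, hW⟩

theorem dominatedDeletions {n : ℕ} (hn : 1 ≤ n) :
    Relation.ReflTransGen (IsDominatedDeletion (simplexVertices n))
      (extremalTournament n).outNbhdComplex (simplexBoundary (simplexVertices n)) := by
  have h : ∀ k ≤ n + 1, Relation.ReflTransGen (IsDominatedDeletion (simplexVertices n))
      (stage n 0) (stage n k) := by
    intro k
    induction k with
    | zero => exact fun _ => Relation.ReflTransGen.refl
    | succ k ih =>
      exact fun hk => (ih (by omega)).tail (isDominatedDeletion_stage hn (by omega))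
  rw [← stage_zero, ← stage_last]
  exact h (n + 1) le_rfl

end extremalTournament

theorem extremalTournament.nonempty_reducedHomology_addEquiv_int {n : ℕ} (hn : 1 ≤ n) :
    Nonempty ((extremalTournament n).outNbhdComplex.ReducedHomology n ≃+ ℤ) := by
  have h := dominatedDeletions hn
  refine PreAbstractSimplicialComplex.nonempty_reducedHomology_addEquiv_int
    (card_simplexVertices n) (fun γ hne hγ => ?_) (fun hS => ?_)
    (acyclic_fill_of_dominatedDeletions h n) (acyclic_fill_of_dominatedDeletions h (n + 1))
  · exact (mem_iff_of_dominatedDeletions h hγ.1).2 ⟨hne, hγ⟩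
  · exact ((mem_iff_of_dominatedDeletions h subset_rfl).1 hS).2.2 subset_rfl

theorem mainTheorem3 (n : ℕ) :
    (∀ (V : Type*) [Fintype V] (G : Digraph V), G.IsSimple → Fintype.card V ≤ 2 * n + 2 →
      (∀ i : ℕ, n ≤ i → Subsingleton (G.outNbhdComplex.ReducedHomology i)) ∧
      G.outNbhdComplex.IsLeray n) ∧
    (1 ≤ n → ∃ T : Digraph (Fin (2 * n + 3)), T.IsTournament ∧
      (∃ S : Finset (Fin (2 * n + 3)), S.card = n + 2 ∧
        T.outNbhdComplex.CollapsesOnto (PreAbstractSimplicialComplex.simplexBoundary S)) ∧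
      Nonempty (T.outNbhdComplex.realization ≃ₕ
        Metric.sphere (0 : EuclideanSpace ℝ (Fin (n + 1))) 1) ∧
      Nonempty (T.outNbhdComplex.ReducedHomology n ≃+ ℤ) ∧
      ¬ T.outNbhdComplex.IsLeray n) := by

  refine ⟨fun V _ G hG hV => ?_, fun hn => ?_⟩
  · have hL := hG.isLeray_outNbhdComplex hV
    refine ⟨fun i hi => ?_, hL⟩
    have h := hL Set.univ i hi
    rwa [induce_univ] at h
  · have h := extremalTournament.dominatedDeletions hn
    have hZ := extremalTournament.nonempty_reducedHomology_addEquiv_int hn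
    refine ⟨extremalTournament n, extremalTournament.isTournament n,
      ⟨_, extremalTournament.card_simplexVertices n, collapsesOnto_of_dominatedDeletions h⟩,
      ?_, hZ, fun hL => ?_⟩
    · obtain ⟨e⟩ := homotopyEquiv_of_dominatedDeletions h
      obtain ⟨e'⟩ := nonempty_simplexBoundary_homeomorph_sphere
        (extremalTournament.card_simplexVertices n)
      exact ⟨e.trans e'.toHomotopyEquiv⟩
    · have hs := hL Set.univ n le_rfl
      rw [induce_univ] at hs
      obtain ⟨e⟩ := hZ
      exact not_subsingleton ℤ e.symm.injective.subsingleton
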